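/- **Theorem (soliton Lax pair: $(\partial+u\partial^{-1})^{n+1}0=0$).** Let $n\ge 1$, let $x,t$ be real variables and let all functions be complex-valued. Consider the KdV equation $u_t=6uu_x+u_{xxx}$ with Lax pair $\hat L=\partial+u\partial^{-1}$, $\hat P=\partial^3+3\partial u$. *Constraint.* A function $u$ on an open set $I\subseteq\mathbb R$ satisfies $\hat L^{n+1}0=0$ if there are functions $f_0,\dots,f_{n+1}$ and $g_0,\dots,g_n$ on $I$ with $f_0=0$, $g_i'=f_i$ (so $g_i=\partial^{-1}f_i$ is an indefinite integral with a free constant of integration for $i\ge1$), $g_0=\partial^{-1}0=1$ (so $f_1=\hat L0=u$), $f_{i+1}=\hat Lf_i=f_i'+u\,g_i$ for $0\le i\le n$, and $f_{n+1}=0$. This is a system of $2n$ first-order ODEs $g_i'=f_i$, $f_i'=f_{i+1}-f_1g_i$ $(1\le i\le n,\ f_{n+1}=0)$ for $(g_1,\dots,g_n,f_1,\dots,f_n)$. For functions of $(x,t)\in I\times J$ the constraint is required at every $t\in J$, with $g_i$ smooth in $(x,t)$. *Solitons.* Let $\kappa_j,\theta_j,c_j\in\mathbb C$ $(1\le j\le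 n)$ be such that the $\kappa_j$ are pairwise distinct, $\kappa_l+\kappa_j\ne0$ for all $l,j$, and $c_j\neq 0$. An $n$-soliton profile on $I$ is a function $u=2\sum_{j}c_jN_j'$, where $$N_l=e^{-2\kappa_lx+\theta_l}\Bigl(1+\sum_{j=1}^n\frac{c_jN_j}{\kappa_l+\kappa_j}\Bigr),\qquad l=1,\dots,n,$$ and this linear system is nonsingular at every point of $I$. An $n$-soliton solution on $I\times J$ is given by the same formulas with $\theta_l$ replaced by $\theta_l-8\kappa_l^3t$. Then: 1. Every $n$-soliton profile on an open set $I$ satisfies $\hat L^{n+1}0=0$ on $I$. Every $n$-soliton solution on $I\times J$ ($I,J$ open) is smooth, solves the KdV equation and satisfies $\hat L^{n+1}0=0$, and the functions $f_i$ can be chosen so that moreover $\partial_tf_i=\hat Pf_i$ for $0\le i\le n$. 2. The general solution of $\hat L^{n+1}0=0$ consists of $n$-solitons: there is a nonzero polynomial $D$ in $2n$ variables over $\mathbb C$, depending only on $n$, such that - every initial datum $(g_1,\dots,g_n,f_1,\dots,f_n)(x_0)=p\in\mathbb C^{2n}$ with $D(p)\ne0$ is realised, on some open interval around $x_0$, by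 an $n$-soliton profile $u$; - if $u$ satisfies the constraint on an open interval $I$ (with functions $f_i,g_i$), and $D\neq0$ at the datum $(g_1,\dots,g_n,f_1,\dots,f_n)(x_0)$ for some $x_0\in I$, then $u$ is an $n$-soliton profile on all of $I$; - if $u$ is a smooth solution of the KdV equation on $I\times J$ ($I,J$ open intervals) that satisfies the constraint there, and $D\ne0$ at the datum at some $(x_0,t_0)\in I\times J$, then $u$ is an $n$-soliton solution on all of $I\times J$. -/

import Mathlib

open scoped ContDiff

noncomputable section

/-- `IsLaxChain n I v f g` says that `(∂ + v ∂⁻¹)^(n+1) 0 = 0` holds on the open set `I ⊆ ℝ`, with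
all intermediate functions displayed: `f 0 = 0`, the function `g i` is the chosen value of
`∂⁻¹ (f i)` (an indefinite integral, whose constant of integration is free for `1 ≤ i`),
`f (i+1) = (∂ + v ∂⁻¹) (f i) = (f i)' + v * g i` for `0 ≤ i ≤ n`, and `f (n+1) = 0`.
The constant `∂⁻¹ 0` of the very first step is normalised to `1`, that is,
`f 1 = (∂ + v ∂⁻¹) 0 = v` (any nonzero constant is reduced to this case by scaling,
while the constant `0` would make the condition empty). -/
structure IsLaxChain (n : ℕ) (I : Set ℝ) (v : ℝ → ℂ) (f g : ℕ → ℝ → ℂ) : Prop where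
  start : ∀ x ∈ I, f 0 x = 0
  normalised : ∀ x ∈ I, g 0 x = 1
  primitive : ∀ i ≤ n, ∀ x ∈ I, HasDerivAt (g i) (f i x) x
  differentiable : ∀ i ≤ n, ∀ x ∈ I, DifferentiableAt ℝ (f i) x
  step : ∀ i ≤ n, ∀ x ∈ I, f (i + 1) x = deriv (f i) x + v x * g i x
  truncation : ∀ x ∈ I, f (n + 1) x = 0

/-- The same constraint for functions of `(x, t) ∈ I × J`: it holds at every time `t ∈ J`, and the
indefinite integrals `g i` are smooth functions of `(x, t)` (their constants of integration are
smooth but otherwise arbitrary functions of `t`). -/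
structure IsLaxChainXT (n : ℕ) (I J : Set ℝ) (u : ℝ → ℝ → ℂ) (f g : ℕ → ℝ → ℝ → ℂ) : Prop where
  chain : ∀ t ∈ J,
    IsLaxChain n I (fun x => u x t) (fun i x => f i x t) (fun i x => g i x t)
  smooth : ∀ i ≤ n, ContDiffOn ℝ ∞ (fun p : ℝ × ℝ => g i p.1 p.2) (I ×ˢ J)

/-- The values at `x` of the unknowns `g 1, …, g n, f 1, …, f n` of the constraint, when this is
read as the system `(g i)' = f i`, `(f i)' = f (i+1) - (f 1) * g i` (with `f (n+1) = 0`) of `2 n`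
first-order ordinary differential equations. -/
def laxData (n : ℕ) (f g : ℕ → ℝ → ℂ) (x : ℝ) : Fin n ⊕ Fin n → ℂ :=
  Sum.elim (fun i => g (i + 1) x) (fun i => f (i + 1) x)

/-- The operator `P = ∂³ + 3 ∂ v`. -/
def laxP (v h : ℝ → ℂ) (x : ℝ) : ℂ :=
  iteratedDeriv 3 h x + 3 * deriv (fun y => v y * h y) x

/-- The KdV equation `u_t = 6 u u_x + u_xxx` on `I × J`. -/
def SolvesKdV (I J : Set ℝ) (u : ℝ → ℝ → ℂ) : Prop :=
  ContDiffOn ℝ ∞ (fun p : ℝ × ℝ => u p.1 p.2) (I ×ˢ J) ∧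
    ∀ x ∈ I, ∀ t ∈ J,
      deriv (fun s => u x s) t =
        6 * u x t * deriv (fun y => u y t) x + iteratedDeriv 3 (fun y => u y t) x

/-- Admissible parameters of an `n`-soliton. -/
structure SolitonAdmissible {n : ℕ} (κ c : Fin n → ℂ) : Prop where
  injective : Function.Injective κ
  add_ne_zero : ∀ l j, κ l + κ j ≠ 0
  amplitude_ne_zero : ∀ j, c j ≠ 0

/-- The matrix of the linear system
`N l - exp (-2 κ l x + θ l) * ∑ j, c j N j / (κ l + κ j) = exp (-2 κ l x + θ l)`. -/
def solitonMatrix {n : ℕ} (κ c θ : Fin n → ℂ) (x : ℝ) : Matrix (Fin n) (Fin n) ℂ :=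
  1 - Matrix.of fun l j => Complex.exp (-2 * κ l * x + θ l) * (c j / (κ l + κ j))

/-- `v` is on `I` the function `2 ∑ j, c j (N j)'`, where `N` solves the (nonsingular) linear system
`N l = exp (-2 κ l x + θ l) (1 + ∑ j, c j N j / (κ l + κ j))`. -/
def IsSolitonFormula {n : ℕ} (κ c θ : Fin n → ℂ) (I : Set ℝ) (v : ℝ → ℂ) : Prop :=
  ∃ N : Fin n → ℝ → ℂ, ∀ x ∈ I,
    (solitonMatrix κ c θ x).det ≠ 0 ∧
    (∀ l, N l x =
      Complex.exp (-2 * κ l * x + θ l) * (1 + ∑ j, c j * N j x / (κ l + κ j))) ∧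
    v x = 2 * ∑ j, c j * deriv (N j) x

/-- `v` is on `I` an `n`-soliton profile (an `n`-soliton at a fixed time). -/
def IsSolitonProfile (n : ℕ) (I : Set ℝ) (v : ℝ → ℂ) : Prop :=
  ∃ κ c θ : Fin n → ℂ, SolitonAdmissible κ c ∧ IsSolitonFormula κ c θ I v

/-- `u` is on `I × J` an `n`-soliton of the KdV equation: the phases move by
`θ l (t) = θ l - 8 (κ l)³ t`, while `κ` and `c` do not depend on `t`. -/
def IsSolitonSolution (n : ℕ) (I J : Set ℝ) (u : ℝ → ℝ → ℂ) : Prop :=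
  ∃ κ c θ : Fin n → ℂ, SolitonAdmissible κ c ∧
    ∀ t ∈ J, IsSolitonFormula κ c (fun l => θ l - 8 * κ l ^ 3 * t) I (fun x => u x t)

end

/-!
The constraint is encoded in the monic polynomial `P(z) = z ^ n + g₁ z ^ (n - 1) + ⋯ + g_n` with
coefficients depending on `x`. With `F = P_x = f₁ z ^ (n - 1) + ⋯ + f_n` it says exactly that
`F_x = z F - u P`, that is, that `exp (-z x / 2) P(z)` solves the Schrödinger equation
`φ'' + u φ = (z / 2) ^ 2 φ` for every `z`. Up to sign, the Wronskian
of the solutions belonging to `z` and `-z` is `W(z) = z P(z) P(-z) + P(z) F(-z) - P(-z) F(z)`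
(`wronskianPoly`), an odd polynomial of degree `2 n + 1`.

The polynomial `D` is the product of the discriminant of `W` and the resultant of `P` and `F`. Where
it does not vanish, `W` has simple roots `0, ± 2 κ_j` (`exists_spectrum`), and at `z = ± 2 κ_j` the
two solutions are proportional: `P(-2 κ_j) = β_j exp (-2 κ_j x) P(2 κ_j)` with `β_j ≠ 0`
(`exists_glue`, `IsLaxChain.isGluedPair`). By Lagrange interpolation at the points `-2 κ_j` these
gluing conditions are the linear system of an `n`-soliton (`isGlued_solitonPoly_iff`), whose matrix
is nonsingular precisely when no nonzero polynomial of degree less than `n` satisfies them. If `Q`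
is such a polynomial, then `P(z) Q(-z) - P(-z) Q(z)` is odd, of degree less than `2 n + 1`, and
vanishes at the `2 n + 1` points `0, ± 2 κ_j`, so it is zero; the same holds with `P` replaced by
`2 F - z P`, and together the two identities give `W Q = 0` (`IsGluedPair.eq_zero`).

Conversely, for a soliton the polynomials `P_xx - z P_x + u P` and, with the KdV phases,
`P_t - P_xxx - 3 u P_x` have degree less than `n` and satisfy the gluing conditions, so they vanish
(`IsSolitonRegion.solitonD_XX`, `IsSolitonRegion.solitonD_T`). The first identity is the constraint,
and the second one contains the KdV equation and the evolution of the `f_i` by `∂³ + 3 ∂ u`. Data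
outside `D = 0` are realised by Picard-Lindelöf.

For a constrained solution of the KdV equation the functions `g_i` may involve arbitrary functions
of `t`. The defect `S = P_t - (z ^ 2 + 2 u) P_x + (z u + u_x) P` solves the same equation in `x` as
`P`, so that `T = P S_x - P_x S` satisfies `T_x = z T`; being a polynomial in `z` of bounded degree,
`T` is zero. Where `P` and `P_x` are coprime, `P` divides `S`, which has degree less than `n`, hence
`S = 0` (`IsKdVChain.evolution`), and then `W` is constant in `t` while the gluing factors vary as
`exp (-8 κ_j ^ 3 t)`. The times at which `W` and the gluing factors have these values form a set
which is closed by continuity and open because the conditions imply that `P` and `P_x` are coprime;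
hence it is the whole interval (`IsKdVChain.isGluedPair_time`).
-/

noncomputable section

open Polynomial

/-! ### Polynomials in the spectral parameter -/

section Poly

variable {R : Type*} [CommRing R]

/-- The polynomial `b 0 X^(n-1) + b 1 X^(n-2) + ⋯ + b (n-1)`. -/
def descPoly (n : ℕ) (b : ℕ → R) : R[X] := ∑ i ∈ Finset.range n, C (b i) * X ^ (n - 1 - i)

lemma descPoly_degree_lt (n : ℕ) (b : ℕ → R) : (descPoly n b).degree < n := by
  rcases Nat.eq_zero_or_pos n with rfl | hn
  · simp [descPoly]
  refine lt_of_le_of_lt (degree_sum_le _ _) ?_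
  refine (Finset.sup_lt_iff (by exact WithBot.bot_lt_coe n)).2 fun i hi => ?_
  refine lt_of_le_of_lt (degree_C_mul_X_pow_le _ _) ?_
  exact_mod_cast (by omega : n - 1 - i < n)

lemma descPoly_map {S : Type*} [CommRing S] (φ : R →+* S) (n : ℕ) (b : ℕ → R) :
    (descPoly n b).map φ = descPoly n (fun i => φ (b i)) := by
  simp [descPoly, Polynomial.map_sum]

/-- Multiplication by `X` shifts the sequence of coefficients; this turns the recursion of the
constraint into an equation between polynomials. -/
lemma X_mul_descPoly (n : ℕ) (b : ℕ → R) :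
    X * descPoly n b + C (b n) = C (b 0) * X ^ n + descPoly n (fun i => b (i + 1)) := by
  have h1 : X * descPoly n b + C (b n) = ∑ i ∈ Finset.range (n + 1), C (b i) * X ^ (n - i) := by
    rw [Finset.sum_range_succ, descPoly, Finset.mul_sum]
    congr 1
    · refine Finset.sum_congr rfl fun i hi => ?_
      have : n - i = n - 1 - i + 1 := by have := Finset.mem_range.1 hi; omega
      rw [this, pow_succ]; ring
    · simp
  rw [h1, Finset.sum_range_succ', add_comm, descPoly]
  congr 1
  refine Finset.sum_congr rfl fun i _ => ?_
  rw [show n - (i + 1) = n - 1 - i by omega]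

lemma coeff_descPoly {n : ℕ} (b : ℕ → R) {i : ℕ} (hi : i < n) :
    (descPoly n b).coeff (n - 1 - i) = b i := by
  rw [descPoly, finsetSum_coeff, Finset.sum_eq_single i]
  · simp
  · intro j hj hji
    rw [coeff_C_mul_X_pow, if_neg]
    have := Finset.mem_range.1 hj; omega
  · simp [hi]

/-- Reading a datum indexed by `Fin n` as a sequence, extended by zero. -/
def extendSeq {n : ℕ} (q : Fin n → R) (i : ℕ) : R := if h : i < n then q ⟨i, h⟩ else 0

lemma extendSeq_of_lt {n : ℕ} (q : Fin n → R) {i : ℕ} (h : i < n) :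
    extendSeq q i = q ⟨i, h⟩ := dif_pos h

/-- The monic polynomial `P = X^n + g₁ X^(n-1) + ⋯ + g_n` attached to a datum `(g, f)`. -/
def wavePoly {n : ℕ} (p : Fin n ⊕ Fin n → R) : R[X] :=
  X ^ n + descPoly n (extendSeq fun i => p (Sum.inl i))

/-- The polynomial `F = f₁ X^(n-1) + ⋯ + f_n` attached to a datum `(g, f)`; along a chain it is the
`x`-derivative of `wavePoly`. -/
def waveDeriv {n : ℕ} (p : Fin n ⊕ Fin n → R) : R[X] :=
  descPoly n (extendSeq fun i => p (Sum.inr i))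

lemma extendSeq_map {S : Type*} [CommRing S] (φ : R →+* S) {n : ℕ} (q : Fin n → R) :
    (fun i => φ (extendSeq q i)) = extendSeq (fun i => φ (q i)) := by
  funext i
  unfold extendSeq
  split_ifs <;> simp

lemma wavePoly_map {S : Type*} [CommRing S] (φ : R →+* S) {n : ℕ} (p : Fin n ⊕ Fin n → R) :
    (wavePoly p).map φ = wavePoly (fun i => φ (p i)) := by
  simp [wavePoly, descPoly_map, extendSeq_map]

lemma waveDeriv_map {S : Type*} [CommRing S] (φ : R →+* S) {n : ℕ} (p : Fin n ⊕ Fin n → R) :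
    (waveDeriv p).map φ = waveDeriv (fun i => φ (p i)) := by
  simp [waveDeriv, descPoly_map, extendSeq_map]

lemma waveDeriv_degree_lt {n : ℕ} (p : Fin n ⊕ Fin n → R) : (waveDeriv p).degree < n :=
  descPoly_degree_lt _ _

lemma wavePoly_monic {n : ℕ} (p : Fin n ⊕ Fin n → R) : (wavePoly p).Monic :=
  monic_X_pow_add (descPoly_degree_lt _ _)

lemma wavePoly_natDegree [Nontrivial R] {n : ℕ} (p : Fin n ⊕ Fin n → R) :
    (wavePoly p).natDegree = n := by
  apply natDegree_eq_of_degree_eq_some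
  rw [wavePoly, degree_add_eq_left_of_degree_lt] <;> rw [degree_X_pow]
  exact descPoly_degree_lt _ _

/-- Every polynomial of degree less than `n` is the `descPoly` of its coefficients. -/
lemma descPoly_coeff {n : ℕ} {Q : R[X]} (hQ : Q.degree < n) :
    descPoly n (extendSeq fun i : Fin n => Q.coeff (n - 1 - i)) = Q := by
  ext k
  by_cases hk : k < n
  · have h := coeff_descPoly (extendSeq fun i : Fin n => Q.coeff (n - 1 - i))
      (show n - 1 - k < n by omega)
    rw [extendSeq_of_lt _ (show n - 1 - k < n by omega)] at h
    simpa [show n - 1 - (n - 1 - k) = k by omega] using h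
  · rw [coeff_eq_zero_of_degree_lt, coeff_eq_zero_of_degree_lt]
    · exact hQ.trans_le (by exact_mod_cast not_lt.1 hk)
    · exact (descPoly_degree_lt _ _).trans_le (by exact_mod_cast not_lt.1 hk)

/-- Up to sign the Wronskian of `exp (-z x / 2) P(z)` and `exp (z x / 2) P(-z)`, where `F` is the
`x`-derivative of `P`. -/
def wronskianPoly (P F : R[X]) : R[X] :=
  X * P * P.comp (-X) + P * F.comp (-X) - P.comp (-X) * F

lemma wronskianPoly_map {S : Type*} [CommRing S] (φ : R →+* S) (P F : R[X]) :
    (wronskianPoly P F).map φ = wronskianPoly (P.map φ) (F.map φ) := by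
  simp [wronskianPoly, Polynomial.map_comp]

lemma wronskianPoly_comp_neg (P F : R[X]) :
    (wronskianPoly P F).comp (-X) = -wronskianPoly P F := by
  simp only [wronskianPoly, sub_comp, add_comp, mul_comp, X_comp, comp_assoc, neg_comp, neg_neg,
    comp_X]
  ring

/-- The leading term of `W` is that of `X P(X) P(-X)`. -/
lemma wronskianPoly_coeff_natDegree [Nontrivial R] {n : ℕ} {P F : R[X]} (hP : P.Monic)
    (hn : P.natDegree = n) (hF : F.degree < n) :
    (wronskianPoly P F).natDegree ≤ 2 * n + 1 ∧
      (wronskianPoly P F).coeff (2 * n + 1) = (-1) ^ n := by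
  have hF' : F.natDegree ≤ n := natDegree_le_of_degree_le hF.le
  have hd : ∀ Q : R[X], (Q.comp (-X)).natDegree ≤ Q.natDegree := fun Q => by
    refine natDegree_comp_le.trans ?_
    simp
  have hP1 := hd P
  have hF1 := hd F
  have h2 : (P * F.comp (-X) - P.comp (-X) * F).natDegree ≤ 2 * n := by
    refine (natDegree_sub_le _ _).trans (max_le ?_ ?_) <;>
    · refine natDegree_mul_le.trans ?_
      omega
  have h1 : (P * P.comp (-X)).natDegree ≤ 2 * n := natDegree_mul_le.trans (by omega)
  have hc : (P * P.comp (-X)).coeff (2 * n) = (-1) ^ n := by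
    rw [two_mul, coeff_mul_add_eq_of_natDegree_le hn.le (by omega)]
    have : P.comp (-X) = P.comp (C (-1) * X) := by simp
    rw [this, comp_C_mul_X_coeff, ← hn, hP.coeff_natDegree]
    simp
  have e : wronskianPoly P F = X * (P * P.comp (-X)) + (P * F.comp (-X) - P.comp (-X) * F) := by
    rw [wronskianPoly]; ring
  constructor
  · rw [e]
    refine (natDegree_add_le _ _).trans (max_le ?_ (by omega))
    refine natDegree_mul_le.trans ?_
    have := natDegree_X_le (R := R)
    omega
  · rw [e, coeff_add, coeff_X_mul, hc, coeff_eq_zero_of_natDegree_lt (by omega), add_zero]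

lemma wronskianPoly_natDegree [Nontrivial R] {n : ℕ} {P F : R[X]} (hP : P.Monic)
    (hn : P.natDegree = n) (hF : F.degree < n) : (wronskianPoly P F).natDegree = 2 * n + 1 := by
  obtain ⟨h1, h2⟩ := wronskianPoly_coeff_natDegree hP hn hF
  refine le_antisymm h1 (le_natDegree_of_ne_zero ?_)
  rw [h2]
  exact ((isUnit_one.neg).pow n).ne_zero

lemma wronskianPoly_ne_zero [Nontrivial R] {n : ℕ} {P F : R[X]} (hP : P.Monic)
    (hn : P.natDegree = n) (hF : F.degree < n) : wronskianPoly P F ≠ 0 := by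
  intro h
  have := wronskianPoly_natDegree hP hn hF
  simp [h] at this

end Poly

/-! ### The exceptional hypersurface -/

/-- The resultant of `P` and `F`, as a polynomial in the datum. -/
def resPoly (n : ℕ) : MvPolynomial (Fin n ⊕ Fin n) ℂ :=
  resultant (wavePoly (MvPolynomial.X : Fin n ⊕ Fin n → MvPolynomial (Fin n ⊕ Fin n) ℂ))
    (waveDeriv MvPolynomial.X) n n

/-- The resultant of `W` and its derivative with respect to the spectral parameter, as a polynomial
in the datum. -/
def discPoly (n : ℕ) : MvPolynomial (Fin n ⊕ Fin n) ℂ :=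
  resultant (wronskianPoly
    (wavePoly (MvPolynomial.X : Fin n ⊕ Fin n → MvPolynomial (Fin n ⊕ Fin n) ℂ))
    (waveDeriv MvPolynomial.X))
    (derivative (wronskianPoly
    (wavePoly (MvPolynomial.X : Fin n ⊕ Fin n → MvPolynomial (Fin n ⊕ Fin n) ℂ))
    (waveDeriv MvPolynomial.X))) (2 * n + 1) (2 * n + 1)

lemma resultant_ne_zero_iff_of_natDegree_le {K : Type*} [Field K] {f g : K[X]} {m k : ℕ}
    (hf : f ≠ 0) (hm : f.natDegree = m) (hg : g.natDegree ≤ k) :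
    resultant f g m k ≠ 0 ↔ IsCoprime f g := by
  obtain ⟨d, rfl⟩ := Nat.exists_eq_add_of_le hg
  subst hm
  rw [resultant_add_right_deg _ _ _ _ _ le_rfl, mul_ne_zero_iff, Ne, Ne, resultant_eq_zero_iff]
  simp [hf]

/-- The resultant is taken with formal degrees `n`, `n`, whereas `F` has degree less than `n`; since
`P` is monic this does not affect its vanishing. -/
lemma eval_resPoly_ne_zero {n : ℕ} (p : Fin n ⊕ Fin n → ℂ) :
    MvPolynomial.eval p (resPoly n) ≠ 0 ↔ IsCoprime (wavePoly p) (waveDeriv p) := by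
  rw [resPoly, ← resultant_map_map, wavePoly_map, waveDeriv_map]
  rw [show (fun i => MvPolynomial.eval p (MvPolynomial.X i)) = p from
    funext fun i => MvPolynomial.eval_X i]
  exact resultant_ne_zero_iff_of_natDegree_le (wavePoly_monic p).ne_zero (wavePoly_natDegree p)
    (natDegree_le_of_degree_le (waveDeriv_degree_lt p).le)

lemma eval_discPoly_ne_zero {n : ℕ} (p : Fin n ⊕ Fin n → ℂ) :
    MvPolynomial.eval p (discPoly n) ≠ 0 ↔
      (wronskianPoly (wavePoly p) (waveDeriv p)).Separable := by
  rw [discPoly, ← resultant_map_map, ← derivative_map, wronskianPoly_map, wavePoly_map,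
    waveDeriv_map]
  rw [show (fun i => MvPolynomial.eval p (MvPolynomial.X i)) = p from
    funext fun i => MvPolynomial.eval_X i]
  have h := wronskianPoly_natDegree (wavePoly_monic p) (wavePoly_natDegree p)
    (waveDeriv_degree_lt p)
  refine resultant_ne_zero_iff_of_natDegree_le (wronskianPoly_ne_zero (wavePoly_monic p)
    (wavePoly_natDegree p) (waveDeriv_degree_lt p)) h ?_
  exact (natDegree_derivative_le _).trans (by omega)

/-- The datum with given polynomials `P` and `F`. -/
lemma exists_datum {n : ℕ} {P F : ℂ[X]} (hP : P.Monic) (hn : P.natDegree = n)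
    (hF : F.degree < n) : ∃ p : Fin n ⊕ Fin n → ℂ, wavePoly p = P ∧ waveDeriv p = F := by
  refine ⟨Sum.elim (fun i : Fin n => (P - X ^ n).coeff (n - 1 - i))
    (fun i : Fin n => F.coeff (n - 1 - i)), ?_, ?_⟩
  · have hd : (P - X ^ n).degree < (n : WithBot ℕ) := by
      have : P.degree = n := by rw [degree_eq_natDegree hP.ne_zero, hn]
      rw [← this]
      refine degree_sub_lt_left (by rw [this, degree_X_pow]) hP.ne_zero ?_
      rw [hP.leadingCoeff, (monic_X_pow n).leadingCoeff]
    rw [wavePoly]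
    simp only [Sum.elim_inl]
    rw [descPoly_coeff hd]
    ring
  · simp only [waveDeriv, Sum.elim_inr]
    exact descPoly_coeff hF

lemma resPoly_ne_zero {n : ℕ} (hn : 1 ≤ n) : resPoly n ≠ 0 := by
  obtain ⟨p, h1, h2⟩ := exists_datum (monic_X_pow (R := ℂ) n) (natDegree_X_pow n)
    (F := 1) (by rw [degree_one]; exact_mod_cast hn)
  intro h
  have := (eval_resPoly_ne_zero p).2 (by rw [h2]; exact isCoprime_one_right)
  simp [h] at this

/-- For `F = 0` and `P = ∏ (X - j)`, `1 ≤ j ≤ n`, the roots of `W` are `0, ±1, …, ±n`. -/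
lemma discPoly_ne_zero (n : ℕ) : discPoly n ≠ 0 := by
  have hm : (∏ j ∈ Finset.range n, (X - C ((j : ℂ) + 1))).Monic :=
    monic_prod_of_monic _ _ fun _ _ => monic_X_sub_C _
  have hd : (∏ j ∈ Finset.range n, (X - C ((j : ℂ) + 1))).natDegree = n := by
    rw [natDegree_prod_of_monic _ _ fun _ _ => monic_X_sub_C _]
    rw [Finset.sum_congr rfl fun j _ => natDegree_X_sub_C _]
    simp
  obtain ⟨p, h1, h2⟩ := exists_datum hm hd (F := 0) (by simp)
  intro h
  have key : (wronskianPoly (wavePoly p) (waveDeriv p)).Separable := by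
    have hne : ∀ i j : ℕ, IsUnit ((i : ℂ) + 1 - -((j : ℂ) + 1)) := fun i j => by
      refine IsUnit.mk0 _ ?_
      rw [sub_neg_eq_add]
      exact_mod_cast (by omega : i + 1 + (j + 1) ≠ 0)
    have hP : (∏ j ∈ Finset.range n, (X - C ((j : ℂ) + 1))).Separable := by
      refine separable_prod_X_sub_C_iff'.2 fun i _ j _ hij => ?_
      exact_mod_cast add_right_cancel hij
    have hPn : (∏ j ∈ Finset.range n, (X - C (-((j : ℂ) + 1)))).Separable := by
      refine separable_prod_X_sub_C_iff'.2 fun i _ j _ hij => ?_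
      exact_mod_cast add_right_cancel (neg_injective hij)
    have e : (∏ j ∈ Finset.range n, (X - C ((j : ℂ) + 1))).comp (-X) =
        C ((-1) ^ n) * ∏ j ∈ Finset.range n, (X - C (-((j : ℂ) + 1))) := by
      have hc : (C ((-1) ^ n) : ℂ[X]) = ∏ j ∈ Finset.range n, C (-1) := by simp
      rw [prod_comp, hc, ← Finset.prod_mul_distrib]
      refine Finset.prod_congr rfl fun j _ => ?_
      simp
      ring
    have hX : ∀ a : ℂ, a ≠ 0 → IsCoprime (X : ℂ[X]) (X - C a) := fun a ha => by
      have := isCoprime_X_sub_C_of_isUnit_sub (R := ℂ) (a := 0) (b := a) (by simpa using ha)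
      simpa using this
    have hW : wronskianPoly (wavePoly p) (waveDeriv p) =
        C ((-1) ^ n) * (X * (∏ j ∈ Finset.range n, (X - C ((j : ℂ) + 1))) *
          ∏ j ∈ Finset.range n, (X - C (-((j : ℂ) + 1)))) := by
      rw [h1, h2, wronskianPoly, e]
      simp
      ring
    rw [hW]
    have hs : (X * (∏ j ∈ Finset.range n, (X - C ((j : ℂ) + 1))) *
          ∏ j ∈ Finset.range n, (X - C (-((j : ℂ) + 1)))).Separable := by
      refine Separable.mul (Separable.mul separable_X hP ?_) hPn ?_
      · exact IsCoprime.prod_right fun j _ => hX _ (by exact_mod_cast Nat.succ_ne_zero j)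
      · refine IsCoprime.prod_right fun j _ => IsCoprime.mul_left ?_ ?_
        · exact hX _ (neg_ne_zero.2 (by exact_mod_cast Nat.succ_ne_zero j))
        · exact IsCoprime.prod_left fun i _ => isCoprime_X_sub_C_of_isUnit_sub (hne i j)
    exact Separable.unit_mul (isUnit_C.2 ((isUnit_one.neg).pow n)) hs
  have := (eval_discPoly_ne_zero p).2 key
  simp [h] at this

/-! ### Coefficientwise derivatives -/

/-- `HasCoeffDerivAt P P' x`: every coefficient of the polynomial-valued function `P` of a real
variable is differentiable at `x`, with derivative the corresponding coefficient of `P'`. -/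
def HasCoeffDerivAt (P : ℝ → ℂ[X]) (P' : ℂ[X]) (x : ℝ) : Prop :=
  ∀ k, HasDerivAt (fun y => (P y).coeff k) (P'.coeff k) x

namespace HasCoeffDerivAt

variable {P Q : ℝ → ℂ[X]} {P' Q' : ℂ[X]} {x : ℝ}

lemma const (A : ℂ[X]) (x : ℝ) : HasCoeffDerivAt (fun _ => A) 0 x := fun k => by
  simpa using hasDerivAt_const x (A.coeff k)

lemma C_fun {a : ℝ → ℂ} {a' : ℂ} (h : HasDerivAt a a' x) :
    HasCoeffDerivAt (fun y => C (a y)) (C a') x := fun k => by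
  rcases Nat.eq_zero_or_pos k with rfl | hk
  · simpa using h
  · simpa [coeff_C, hk.ne'] using hasDerivAt_const x (0 : ℂ)

lemma add (hP : HasCoeffDerivAt P P' x) (hQ : HasCoeffDerivAt Q Q' x) :
    HasCoeffDerivAt (fun y => P y + Q y) (P' + Q') x := fun k => by
  simpa only [coeff_add] using (hP k).fun_add (hQ k)

lemma sub (hP : HasCoeffDerivAt P P' x) (hQ : HasCoeffDerivAt Q Q' x) :
    HasCoeffDerivAt (fun y => P y - Q y) (P' - Q') x := fun k => by
  simpa only [coeff_sub] using (hP k).fun_sub (hQ k)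

lemma mul (hP : HasCoeffDerivAt P P' x) (hQ : HasCoeffDerivAt Q Q' x) :
    HasCoeffDerivAt (fun y => P y * Q y) (P' * Q x + P x * Q') x := fun k => by
  simp only [coeff_mul, coeff_add]
  rw [← Finset.sum_add_distrib]
  exact HasDerivAt.fun_sum fun i _ => (hP i.1).fun_mul (hQ i.2)

lemma sum {ι : Type*} (s : Finset ι) {A : ι → ℝ → ℂ[X]} {A' : ι → ℂ[X]}
    (h : ∀ i ∈ s, HasCoeffDerivAt (A i) (A' i) x) :
    HasCoeffDerivAt (fun y => ∑ i ∈ s, A i y) (∑ i ∈ s, A' i) x := fun k => by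
  simp only [finsetSum_coeff]
  exact HasDerivAt.fun_sum fun i hi => h i hi k

lemma const_mul (A : ℂ[X]) (hP : HasCoeffDerivAt P P' x) :
    HasCoeffDerivAt (fun y => A * P y) (A * P') x := by
  simpa using (const A x).mul hP

lemma comp_neg (hP : HasCoeffDerivAt P P' x) :
    HasCoeffDerivAt (fun y => (P y).comp (-X)) (P'.comp (-X)) x := fun k => by
  have e : ∀ A : ℂ[X], (A.comp (-X)).coeff k = A.coeff k * (-1) ^ k := fun A => by
    rw [← comp_C_mul_X_coeff]; simp
  simp only [e]
  exact (hP k).mul_const _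

lemma unique {P'' : ℂ[X]} (h : HasCoeffDerivAt P P' x) (h' : HasCoeffDerivAt P P'' x) :
    P' = P'' := by
  ext k
  exact (h k).unique (h' k)

lemma congr {I : Set ℝ} (hI : IsOpen I) (hx : x ∈ I) (h : HasCoeffDerivAt P P' x)
    (e : ∀ y ∈ I, Q y = P y) : HasCoeffDerivAt Q P' x := fun k => by
  refine (h k).congr_of_eventuallyEq ?_
  filter_upwards [hI.mem_nhds hx] with y hy
  rw [e y hy]

/-- Evaluation at a point commutes with coefficientwise differentiation, when the degrees are
bounded. -/
lemma eval (hP : HasCoeffDerivAt P P' x) {N : ℕ} (hN : ∀ y, (P y).natDegree < N) (z : ℂ) :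
    HasDerivAt (fun y => (P y).eval z) (P'.eval z) x := by
  have hN' : P'.natDegree < N := by
    have hpos : 0 < N := (Nat.zero_le _).trans_lt (hN x)
    refine lt_of_le_of_lt (natDegree_le_iff_coeff_eq_zero.2 fun k hk => ?_) (Nat.sub_one_lt hpos.ne')
    refine (hP k).unique ((hasDerivAt_const x (0 : ℂ)).congr_of_eventuallyEq ?_)
    exact Filter.Eventually.of_forall fun y =>
      coeff_eq_zero_of_natDegree_lt ((hN y).trans_le (by omega))
  simp only [fun y => eval_eq_sum_range' (hN y) z, eval_eq_sum_range' hN' z]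
  exact HasDerivAt.fun_sum fun i _ => (hP i).mul_const _

end HasCoeffDerivAt

lemma hasCoeffDerivAt_descPoly {n : ℕ} {b : ℝ → ℕ → ℂ} {b' : ℕ → ℂ} {x : ℝ}
    (h : ∀ i < n, HasDerivAt (fun y => b y i) (b' i) x) :
    HasCoeffDerivAt (fun y => descPoly n (b y)) (descPoly n b') x := by
  refine HasCoeffDerivAt.sum _ fun i hi => ?_
  have := (HasCoeffDerivAt.C_fun (h i (Finset.mem_range.1 hi))).mul
    (HasCoeffDerivAt.const (X ^ (n - 1 - i)) x)
  simpa using this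

/-- A polynomial-valued function with vanishing derivative is constant on an interval. -/
lemma eq_of_hasCoeffDerivAt_zero {P : ℝ → ℂ[X]} {I : Set ℝ} (hI : IsOpen I)
    (hc : I.OrdConnected) (h : ∀ x ∈ I, HasCoeffDerivAt P 0 x) {x y : ℝ} (hx : x ∈ I) (hy : y ∈ I) : P x = P y := by
  ext k
  refine hI.is_const_of_deriv_eq_zero (f := fun y => (P y).coeff k) hc.isPreconnected
    (fun s hs => (h s hs k).differentiableAt.differentiableWithinAt) (fun s hs => ?_) hx hy
  simpa using (h s hs k).deriv

/-- If `T' = X T` coefficientwise on an open set, then `T = 0`: the coefficients vanish successively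
from above, because the degree of `T` does not exceed that of `T'`. -/
lemma eq_zero_of_hasCoeffDerivAt_X_mul {T : ℝ → ℂ[X]} {I : Set ℝ} (hI : IsOpen I) {N : ℕ}
    (hN : ∀ x ∈ I, (T x).natDegree < N)
    (h : ∀ x ∈ I, HasCoeffDerivAt T (X * T x) x) {x : ℝ} (hx : x ∈ I) : T x = 0 := by
  have key : ∀ j k, N ≤ k + j → ∀ y ∈ I, (T y).coeff k = 0 := by
    intro j
    induction j with
    | zero => intro k hk y hy; exact coeff_eq_zero_of_natDegree_lt ((hN y hy).trans_le hk)
    | succ j ih =>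
      intro k hk y hy
      have h1 := h y hy (k + 1)
      rw [coeff_X_mul] at h1
      refine h1.unique ((hasDerivAt_const y (0 : ℂ)).congr_of_eventuallyEq ?_)
      filter_upwards [hI.mem_nhds hy] with s hs
      exact ih (k + 1) (by omega) s hs
  ext k
  simpa using key N k (by omega) x hx

/-! ### Linear differential equations -/

/-- Uniqueness for linear systems of two equations on an interval. -/
lemma linear_system_eq_zero {I : Set ℝ} (hc : I.OrdConnected) {a b c d y₁ y₂ : ℝ → ℂ}
    (ha : ContinuousOn a I) (hb : ContinuousOn b I) (hc' : ContinuousOn c I)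
    (hd : ContinuousOn d I)
    (h₁ : ∀ x ∈ I, HasDerivAt y₁ (a x * y₁ x + b x * y₂ x) x)
    (h₂ : ∀ x ∈ I, HasDerivAt y₂ (c x * y₁ x + d x * y₂ x) x) {x₀ : ℝ} (hx₀ : x₀ ∈ I)
    (h0₁ : y₁ x₀ = 0) (h0₂ : y₂ x₀ = 0) {x : ℝ} (hx : x ∈ I) : y₁ x = 0 ∧ y₂ x = 0 := by
  have right : ∀ {a b c d y₁ y₂ : ℝ → ℂ} {s t : ℝ}, s ≤ t →
      ContinuousOn a (Set.Icc s t) → ContinuousOn b (Set.Icc s t) →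
      ContinuousOn c (Set.Icc s t) → ContinuousOn d (Set.Icc s t) →
      (∀ x ∈ Set.Icc s t, HasDerivAt y₁ (a x * y₁ x + b x * y₂ x) x) →
      (∀ x ∈ Set.Icc s t, HasDerivAt y₂ (c x * y₁ x + d x * y₂ x) x) →
      y₁ s = 0 → y₂ s = 0 → y₁ t = 0 ∧ y₂ t = 0 := by
    intro a b c d y₁ y₂ s t hst ha hb hc hd h₁ h₂ e₁ e₂
    obtain ⟨K, hK⟩ := isCompact_Icc.exists_bound_of_continuousOn
      (f := fun x => ‖a x‖ + ‖b x‖ + ‖c x‖ + ‖d x‖) (((ha.norm.add hb.norm).add hc.norm).add hd.norm)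
    have hy : ∀ x ∈ Set.Icc s t, HasDerivAt (fun x => (y₁ x, y₂ x))
        (a x * y₁ x + b x * y₂ x, c x * y₁ x + d x * y₂ x) x :=
      fun x hx => (h₁ x hx).prodMk (h₂ x hx)
    have := eq_zero_of_abs_deriv_le_mul_abs_self_of_eq_zero_right (f := fun x => (y₁ x, y₂ x))
      (f' := fun x => (a x * y₁ x + b x * y₂ x, c x * y₁ x + d x * y₂ x)) (K := K)
      (fun x hx => (hy x hx).continuousAt.continuousWithinAt)
      (fun x hx => (hy x (Set.Ico_subset_Icc_self hx)).hasDerivWithinAt)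
      (by simp [e₁, e₂]) (fun x hx => by
        have hb := hK x (Set.Ico_subset_Icc_self hx)
        rw [Real.norm_of_nonneg (by positivity)] at hb
        refine le_trans ?_ (mul_le_mul_of_nonneg_right hb (norm_nonneg _))
        have n1 : ‖y₁ x‖ ≤ ‖(y₁ x, y₂ x)‖ := norm_fst_le (y₁ x, y₂ x)
        have n2 : ‖y₂ x‖ ≤ ‖(y₁ x, y₂ x)‖ := norm_snd_le (y₁ x, y₂ x)
        have aux : ∀ p q : ℂ, ‖p * y₁ x + q * y₂ x‖ ≤ (‖p‖ + ‖q‖) * ‖(y₁ x, y₂ x)‖ := by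
          intro p q
          refine (norm_add_le _ _).trans ?_
          rw [norm_mul, norm_mul, add_mul]
          gcongr
        rw [Prod.norm_mk]
        refine max_le ((aux _ _).trans ?_) ((aux _ _).trans ?_) <;>
        · refine mul_le_mul_of_nonneg_right ?_ (norm_nonneg _)
          linarith [norm_nonneg (a x), norm_nonneg (b x), norm_nonneg (c x), norm_nonneg (d x)])
      t (Set.right_mem_Icc.2 hst)
    simpa using this
  rcases le_total x₀ x with hle | hle
  · have hs := hc.out hx₀ hx
    exact right hle (ha.mono hs) (hb.mono hs) (hc'.mono hs) (hd.mono hs)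
      (fun s h => h₁ s (hs h)) (fun s h => h₂ s (hs h)) h0₁ h0₂
  · have hs := hc.out hx hx₀
    have hm : Set.MapsTo (fun s : ℝ => -s) (Set.Icc (-x₀) (-x)) (Set.Icc x x₀) := fun s h =>
      ⟨by linarith [h.2], by linarith [h.1]⟩
    have hcomp : ∀ {e : ℝ → ℂ}, ContinuousOn e I →
        ContinuousOn (fun s => -e (-s)) (Set.Icc (-x₀) (-x)) := fun he =>
      ((he.mono hs).comp continuous_neg.continuousOn hm).neg
    have := right (y₁ := fun s => y₁ (-s)) (y₂ := fun s => y₂ (-s)) (neg_le_neg hle)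
      (hcomp ha) (hcomp hb) (hcomp hc') (hcomp hd)
      (fun s h => by
        have := (h₁ (-s) (hs (hm h))).scomp s (hasDerivAt_neg s)
        rw [neg_one_smul] at this
        exact this.congr_deriv (by ring))
      (fun s h => by
        have := (h₂ (-s) (hs (hm h))).scomp s (hasDerivAt_neg s)
        rw [neg_one_smul] at this
        exact this.congr_deriv (by ring)) (by simpa using h0₁) (by simpa using h0₂)
    simpa using this

/-! ### The constraint as an equation for a polynomial -/

lemma descPoly_congr {R : Type*} [CommRing R] {n : ℕ} {b b' : ℕ → R} (h : ∀ i < n, b i = b' i) :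
    descPoly n b = descPoly n b' :=
  Finset.sum_congr rfl fun i hi => by rw [h i (Finset.mem_range.1 hi)]

lemma descPoly_sub {R : Type*} [CommRing R] (n : ℕ) (b b' : ℕ → R) :
    descPoly n (fun i => b i - b' i) = descPoly n b - descPoly n b' := by
  simp only [descPoly, map_sub, sub_mul, Finset.sum_sub_distrib]

lemma descPoly_const_mul {R : Type*} [CommRing R] (n : ℕ) (a : R) (b : ℕ → R) :
    descPoly n (fun i => a * b i) = C a * descPoly n b := by
  simp only [descPoly, map_mul, mul_assoc, Finset.mul_sum]

lemma wavePoly_laxData (n : ℕ) (f g : ℕ → ℝ → ℂ) (x : ℝ) :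
    wavePoly (laxData n f g x) = X ^ n + descPoly n (fun i => g (i + 1) x) := by
  rw [wavePoly, descPoly_congr (b' := fun i => g (i + 1) x)]
  exact fun i hi => by rw [extendSeq_of_lt _ hi, laxData, Sum.elim_inl]

lemma waveDeriv_laxData (n : ℕ) (f g : ℕ → ℝ → ℂ) (x : ℝ) :
    waveDeriv (laxData n f g x) = descPoly n (fun i => f (i + 1) x) := by
  rw [waveDeriv, descPoly_congr (b' := fun i => f (i + 1) x)]
  exact fun i hi => by rw [extendSeq_of_lt _ hi, laxData, Sum.elim_inr]

namespace IsLaxChain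

variable {n : ℕ} {I : Set ℝ} {v : ℝ → ℂ} {f g : ℕ → ℝ → ℂ}

lemma f_one (h : IsLaxChain n I v f g) (hI : IsOpen I) {x : ℝ} (hx : x ∈ I) : f 1 x = v x := by
  have h0 : deriv (f 0) x = 0 := by
    refine ((hasDerivAt_const x (0 : ℂ)).congr_of_eventuallyEq ?_).deriv
    filter_upwards [hI.mem_nhds hx] with y hy using h.start y hy
  rw [h.step 0 (Nat.zero_le _) x hx, h0, h.normalised x hx, zero_add, mul_one]

lemma hasDerivAt_f (h : IsLaxChain n I v f g) {i : ℕ} (hi : i ≤ n) {x : ℝ} (hx : x ∈ I) :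
    HasDerivAt (f i) (f (i + 1) x - v x * g i x) x := by
  have := (h.differentiable i hi x hx).hasDerivAt
  rwa [eq_sub_of_add_eq (h.step i hi x hx).symm] at this

lemma continuousOn (h : IsLaxChain n I v f g) (hI : IsOpen I) (hn : 1 ≤ n) :
    ContinuousOn v I := by
  have : ContinuousOn (f 1) I := fun x hx =>
    (h.differentiable 1 hn x hx).continuousAt.continuousWithinAt
  exact this.congr fun x hx => (h.f_one hI hx).symm

lemma hasCoeffDerivAt_wavePoly (h : IsLaxChain n I v f g) {x : ℝ} (hx : x ∈ I) :
    HasCoeffDerivAt (fun y => wavePoly (laxData n f g y)) (waveDeriv (laxData n f g x)) x := by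
  simp only [wavePoly_laxData, waveDeriv_laxData]
  have := (HasCoeffDerivAt.const (X ^ n) x).add (hasCoeffDerivAt_descPoly
    (b := fun y i => g (i + 1) y) (b' := fun i => f (i + 1) x) (n := n)
    fun i hi => h.primitive (i + 1) hi x hx)
  simpa using this

/-- The second order equation `P'' - X P' + v P = 0` contained in the constraint. -/
lemma hasCoeffDerivAt_waveDeriv (h : IsLaxChain n I v f g) (hI : IsOpen I) {x : ℝ} (hx : x ∈ I) :
    HasCoeffDerivAt (fun y => waveDeriv (laxData n f g y))
      (X * waveDeriv (laxData n f g x) - C (v x) * wavePoly (laxData n f g x)) x := by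
  simp only [wavePoly_laxData, waveDeriv_laxData]
  have h1 := hasCoeffDerivAt_descPoly
    (b := fun y i => f (i + 1) y) (b' := fun i => f (i + 2) x - v x * g (i + 1) x) (n := n)
    fun i hi => h.hasDerivAt_f (i := i + 1) hi hx
  have h2 := X_mul_descPoly n (fun i => f (i + 1) x)
  simp only [h.truncation x hx, map_zero, add_zero, zero_add, h.f_one hI hx] at h2
  rw [descPoly_sub, descPoly_const_mul] at h1
  rw [h2]
  convert h1 using 1
  ring

end IsLaxChain

/-! ### The spectrum -/

/-- An odd separable polynomial of degree `2 n + 1` has the roots `0` and `± 2 κ j`. -/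
lemma exists_spectrum {n : ℕ} {W : ℂ[X]} (hodd : W.comp (-X) = -W)
    (hdeg : W.natDegree = 2 * n + 1) (hsep : W.Separable) :
    ∃ κ : Fin n → ℂ, Function.Injective κ ∧ (∀ l j, κ l + κ j ≠ 0) ∧
      (∀ j, W.eval (2 * κ j) = 0) ∧
      ∀ z, W.eval z = 0 → z = 0 ∨ ∃ j, z = 2 * κ j ∨ z = -(2 * κ j) := by
  -- `W = X w(X²)`, and the `κ j` are the halves of square roots of the roots of `w`
  have heven : ∀ m, W.coeff (2 * m) = 0 := fun m => by
    have h := congrArg (fun Q => Polynomial.coeff Q (2 * m)) hodd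
    have e : W.comp (-X) = W.comp (C (-1) * X) := by simp
    simp only [e, comp_C_mul_X_coeff, coeff_neg, pow_mul] at h
    have : W.coeff (2 * m) = -W.coeff (2 * m) := by simpa using h
    linear_combination this / 2
  obtain ⟨w, hw⟩ : ∃ w : ℂ[X], W = X * expand ℂ 2 w := by
    refine ⟨contract 2 (divX W), ?_⟩
    ext k
    rcases k with _ | k
    · simpa using heven 0
    · rw [coeff_X_mul, coeff_expand two_pos, coeff_contract two_ne_zero, coeff_divX]
      split_ifs with hk
      · rw [Nat.div_mul_cancel hk]
      · obtain ⟨m, hm⟩ : ∃ m, k + 1 = 2 * m := ⟨(k + 1) / 2, by omega⟩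
        rw [hm, heven]
  have hw0 : w ≠ 0 := by
    rintro rfl
    simp [hw] at hdeg
  have hwdeg : w.natDegree = n := by
    rw [hw, natDegree_X_mul (by simpa [expand_eq_zero] using hw0), natDegree_expand] at hdeg
    omega
  have hsq : Squarefree W := hsep.squarefree
  have hwsq : Squarefree w := by
    rintro a ⟨b, hb⟩
    have : IsUnit (expand ℂ 2 a) := hsq _ ⟨X * expand ℂ 2 b, by rw [hw, hb]; simp; ring⟩
    exact (isLocalHom_expand ℂ two_pos).map_nonunit a this
  have hwz : w.eval 0 ≠ 0 := by
    intro h0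
    have h1 : X ∣ expand ℂ 2 w := by
      rw [X_dvd_iff, coeff_zero_eq_eval_zero, expand_eval]
      simpa using h0
    obtain ⟨b, hb⟩ := h1
    have := hsq X ⟨b, by rw [hw, hb]; ring⟩
    exact not_isUnit_X this
  have hnd : w.roots.Nodup := nodup_roots (PerfectField.separable_iff_squarefree.2 hwsq)
  have hcard : w.roots.toFinset.card = n := by
    rw [Multiset.toFinset_card_of_nodup hnd, ← hwdeg]
    exact (IsAlgClosed.splits w).natDegree_eq_card_roots.symm
  let e := w.roots.toFinset.equivFinOfCardEq hcard
  have hroot : ∀ j, w.eval (e.symm j : ℂ) = 0 := fun j => by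
    have := (e.symm j).2
    rw [Multiset.mem_toFinset, mem_roots hw0] at this
    exact this
  have hsqrt : ∀ j, ∃ r : ℂ, r ^ 2 = (e.symm j : ℂ) := fun j =>
    IsAlgClosed.exists_pow_nat_eq _ two_pos
  choose r hr using hsqrt
  have hr0 : ∀ j, r j ≠ 0 := fun j h => hwz (by
    have := hroot j
    rwa [← hr j, h, zero_pow two_ne_zero] at this)
  have hrinj : ∀ l j, r l ^ 2 = r j ^ 2 → l = j := fun l j h => by
    rw [hr, hr] at h
    exact e.symm.injective (Subtype.ext h)
  have h2 : ∀ j, 2 * (r j / 2) = r j := fun j => by ring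
  refine ⟨fun j => r j / 2, fun l j h => ?_, fun l j h => ?_, fun j => ?_, fun z hz => ?_⟩
  · exact hrinj l j (by rw [← h2 l, ← h2 j]; simp only at h; rw [h])
  · have hlj : r l = -r j := by linear_combination 2 * h
    obtain rfl := hrinj l j (by rw [hlj]; ring)
    exact hr0 l (by linear_combination hlj / 2)
  · rw [h2, hw, eval_mul, expand_eval, hr, hroot, mul_zero]
  · simp only [h2]
    rw [hw, eval_mul, eval_X, expand_eval, mul_eq_zero] at hz
    refine hz.imp_right fun hz => ?_
    have hmem : z ^ 2 ∈ w.roots.toFinset := by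
      rw [Multiset.mem_toFinset, mem_roots hw0]
      exact hz
    refine ⟨e ⟨z ^ 2, hmem⟩, ?_⟩
    have := hr (e ⟨z ^ 2, hmem⟩)
    rw [Equiv.symm_apply_apply] at this
    exact sq_eq_sq_iff_eq_or_eq_neg.1 this.symm

/-! ### Gluing conditions -/

/-- The values of `Q` at the points `2 κ l` and `-2 κ l` are proportional, with factors `β l`. For the
polynomial `P` of a chain these conditions express that the solutions
`exp (∓ κ l x) P(± 2 κ l)` of one and the same Schrödinger equation are linearly dependent. -/
def IsGlued {n : ℕ} (κ β : Fin n → ℂ) (Q : ℂ[X]) : Prop :=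
  ∀ l, Q.eval (-(2 * κ l)) = β l * Q.eval (2 * κ l)

/-- The gluing conditions for `P` and its `x`-derivative `F`, where the factors vary as
`exp (-2 κ l x)`. -/
def IsGluedPair {n : ℕ} (κ β : Fin n → ℂ) (P F : ℂ[X]) : Prop :=
  IsGlued κ β P ∧ ∀ l, F.eval (-(2 * κ l)) = β l * (F.eval (2 * κ l) - 2 * κ l * P.eval (2 * κ l))

/-- Where `W` vanishes the two solutions are proportional. -/
lemma exists_glue {P F : ℂ[X]} (hcop : IsCoprime P F) {k : ℂ}
    (hW : (wronskianPoly P F).eval (2 * k) = 0) :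
    ∃ β ≠ 0, P.eval (-(2 * k)) = β * P.eval (2 * k) ∧
      F.eval (-(2 * k)) = β * (F.eval (2 * k) - 2 * k * P.eval (2 * k)) := by
  obtain ⟨A, B, hAB⟩ := hcop
  have hne : ∀ z, ¬ (P.eval z = 0 ∧ F.eval z = 0) := fun z h => by
    have := congrArg (Polynomial.eval z) hAB
    simp [h.1, h.2] at this
  simp only [wronskianPoly, eval_sub, eval_add, eval_mul, eval_X, eval_comp, eval_neg] at hW
  have h1 := hne (2 * k)
  have h2 := hne (-(2 * k))
  generalize P.eval (2 * k) = a at *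
  generalize F.eval (2 * k) = b at *
  generalize P.eval (-(2 * k)) = a' at *
  generalize F.eval (-(2 * k)) = b' at *
  by_cases ha : a = 0
  · subst ha
    have hb : b ≠ 0 := fun hb => h1 ⟨rfl, hb⟩
    have ha' : a' = 0 := by
      have : a' * b = 0 := by linear_combination -hW
      exact (mul_eq_zero.1 this).resolve_right hb
    refine ⟨b' / b, div_ne_zero (fun hb' => h2 ⟨ha', hb'⟩) hb, by simp [ha'], ?_⟩
    field_simp
    ring
  · have key : b' = a' / a * (b - 2 * k * a) := by
      field_simp
      linear_combination hW
    refine ⟨a' / a, div_ne_zero (fun ha' => h2 ⟨ha', by simp [key, ha']⟩) ha, ?_, key⟩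
    field_simp

section Glue

variable {n : ℕ} {κ β : Fin n → ℂ} {P F Q A : ℂ[X]}

/-- If `A` and `Q` satisfy the same gluing conditions, the odd polynomial `A(z) Q(-z) - A(-z) Q(z)`
vanishes at the `2 n + 1` points `0, ± 2 κ l`. -/
lemma IsGlued.mul_comp_neg_eq (hinj : Function.Injective κ) (hadd : ∀ l j, κ l + κ j ≠ 0)
    (hA : IsGlued κ β A) (hQ : IsGlued κ β Q) (hd : A.natDegree + Q.natDegree ≤ 2 * n) :
    A * Q.comp (-X) = A.comp (-X) * Q := by
  rw [← sub_eq_zero]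
  let pt : Option (Fin n ⊕ Fin n) → ℂ :=
    fun o => o.elim 0 (Sum.elim (fun l => 2 * κ l) (fun l => -(2 * κ l)))
  have hκ : ∀ l, κ l ≠ 0 := fun l h => hadd l l (by simp [h])
  have hpt : Function.Injective pt := by
    rintro (_ | a | a) (_ | b | b) h <;> simp [pt] at h ⊢
    · exact hκ b h
    · exact absurd h (hκ b)
    · exact absurd h (hκ a)
    · exact hinj h
    · exact absurd (by linear_combination h / 2) (hadd a b)
    · exact absurd h (hκ a)
    · exact absurd (by linear_combination -h / 2) (hadd a b)
    · exact hinj h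
  refine eq_zero_of_natDegree_lt_card_of_eval_eq_zero _ hpt ?_ ?_
  · rintro (_ | l | l)
    · simp [pt]
    · simp only [pt, Option.elim, Sum.elim_inl, eval_sub, eval_mul, eval_comp, eval_neg, eval_X,
        hA l, hQ l]
      ring
    · simp only [pt, Option.elim, Sum.elim_inr, eval_sub, eval_mul, eval_comp, eval_neg, eval_X,
        neg_neg, hA l, hQ l]
      ring
  · have hc : ∀ B : ℂ[X], (B.comp (-X)).natDegree ≤ B.natDegree := fun B =>
      natDegree_comp_le.trans (by simp)
    have h1 := hc A
    have h2 := hc Q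
    simp only [Fintype.card_option, Fintype.card_sum, Fintype.card_fin]
    refine lt_of_le_of_lt ((natDegree_sub_le _ _).trans (max_le
      (natDegree_mul_le.trans (Nat.add_le_add_left h2 _))
      (natDegree_mul_le.trans (Nat.add_le_add_right h1 _)))) ?_
    omega

/-- No nonzero polynomial of degree less than `n` satisfies the gluing conditions of a monic `P` of
degree `n`. -/
lemma IsGluedPair.eq_zero (hinj : Function.Injective κ) (hadd : ∀ l j, κ l + κ j ≠ 0)
    (hPF : IsGluedPair κ β P F) (hP : P.Monic) (hn : P.natDegree = n) (hF : F.degree < n)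
    (hQ : IsGlued κ β Q) (hQn : Q.degree < n) : Q = 0 := by
  by_contra hQ0
  have hQd : Q.natDegree < n := by rwa [← natDegree_lt_iff_degree_lt hQ0] at hQn
  have h1 : P * Q.comp (-X) = P.comp (-X) * Q :=
    hPF.1.mul_comp_neg_eq hinj hadd hQ (by omega)
  -- `2 F - X P` stands for the derivative of the solution `exp (-z x / 2) P(z)`
  have hglue : IsGlued κ β (2 * F - X * P) := fun l => by
    simp only [eval_sub, eval_mul, eval_X, hPF.1 l, hPF.2 l, eval_ofNat]
    ring
  have hd2 : (2 * F - X * P).natDegree ≤ n + 1 := by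
    refine (natDegree_sub_le _ _).trans (max_le ?_ ?_)
    · refine natDegree_mul_le.trans ?_
      have := natDegree_le_of_degree_le hF.le
      have h2 : (2 : ℂ[X]).natDegree = 0 := natDegree_ofNat 2
      omega
    · refine natDegree_mul_le.trans ?_
      have := natDegree_X_le (R := ℂ)
      omega
  have h2 := hglue.mul_comp_neg_eq hinj hadd hQ (by omega)
  have h3 : wronskianPoly P F * (2 * Q) = 0 := by
    simp only [sub_comp, mul_comp, X_comp, ofNat_comp] at h2
    have e : wronskianPoly P F * (2 * Q) * Q.comp (-X) = 0 := by
      rw [wronskianPoly]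
      linear_combination (2 * F.comp (-X) + X * P.comp (-X)) * Q * h1 - P.comp (-X) * Q * h2
    refine (mul_eq_zero.1 e).resolve_right ?_
    rwa [comp_neg_X_eq_zero_iff]
  rcases mul_eq_zero.1 h3 with h | h
  · exact wronskianPoly_ne_zero hP hn hF h
  · simp [hQ0] at h

/-- A common root of `P` and `F` would be a double root of `W`. -/
lemma IsGluedPair.isCoprime (hPF : IsGluedPair κ β P F) (hβ : ∀ l, β l ≠ 0)
    (hsep : (wronskianPoly P F).Separable)
    (hroots : ∀ z, (wronskianPoly P F).eval z = 0 →
      z = 0 ∨ ∃ j, z = 2 * κ j ∨ z = -(2 * κ j)) : IsCoprime P F := by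
  refine isCoprime_of_irreducible_dvd ?_ ?_
  · rintro ⟨rfl, rfl⟩
    simp only [wronskianPoly, mul_zero, zero_comp, sub_zero, add_zero] at hsep
    exact hsep.ne_zero rfl
  intro A hA hAP hAF
  obtain ⟨z, hz⟩ := IsAlgClosed.exists_root A (fun h => hA.1 (isUnit_iff_degree_eq_zero.2 h))
  have hP := eval_eq_zero_of_dvd_of_eval_eq_zero hAP hz
  have hF := eval_eq_zero_of_dvd_of_eval_eq_zero hAF hz
  have hneg : P.eval (-z) = 0 ∧ F.eval (-z) = 0 := by
    have hW : (wronskianPoly P F).eval z = 0 := by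
      simp [wronskianPoly, hP, hF]
    rcases hroots z hW with rfl | ⟨j, rfl | rfl⟩
    · simp [hP, hF]
    · rw [hPF.1, hPF.2, hP, hF]; simp
    · have h1 := hPF.1 j
      have h2 := hPF.2 j
      rw [hP, zero_eq_mul, or_iff_right (hβ j)] at h1
      rw [hF, zero_eq_mul, or_iff_right (hβ j), h1] at h2
      rw [neg_neg]
      exact ⟨h1, by simpa using h2⟩
  have hroot : ∀ B : ℂ[X], B.eval (-z) = 0 → X - C z ∣ B.comp (-X) := fun B hB => by
    rw [dvd_iff_isRoot, IsRoot.def, eval_comp]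
    simpa using hB
  obtain ⟨a, ha⟩ := dvd_iff_isRoot.2 hP
  obtain ⟨b, hb⟩ := dvd_iff_isRoot.2 hF
  obtain ⟨a', ha'⟩ := hroot P hneg.1
  obtain ⟨b', hb'⟩ := hroot F hneg.2
  have := hsep.squarefree (X - C z) ⟨X * a * a' + a * b' - a' * b, by
    rw [wronskianPoly, ha', hb']
    nth_rw 1 2 [ha]
    nth_rw 1 [hb]
    ring⟩
  exact not_isUnit_X_sub_C z this

end Glue

/-- Along a chain the gluing conditions propagate, with factors varying as `exp (-2 κ l x)`. -/
lemma IsLaxChain.isGluedPair {n : ℕ} {I : Set ℝ} {v : ℝ → ℂ} {f g : ℕ → ℝ → ℂ}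
    (h : IsLaxChain n I v f g) (hI : IsOpen I) (hc : I.OrdConnected) (hn : 1 ≤ n)
    {κ β : Fin n → ℂ} {x₀ x : ℝ} (hx₀ : x₀ ∈ I) (hx : x ∈ I)
    (h0 : IsGluedPair κ β (wavePoly (laxData n f g x₀)) (waveDeriv (laxData n f g x₀))) :
    IsGluedPair κ (fun l => β l * Complex.exp (-2 * κ l * (x - x₀)))
      (wavePoly (laxData n f g x)) (waveDeriv (laxData n f g x)) := by
  have key : ∀ l, _ := fun l => by
    have hE : ∀ y : ℝ, HasDerivAt (fun y : ℝ => β l * Complex.exp (-2 * κ l * (y - x₀)))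
        (-2 * κ l * (β l * Complex.exp (-2 * κ l * (y - x₀)))) y := fun y => by
      have h1 : HasDerivAt (fun y : ℝ => -2 * κ l * ((y : ℂ) - x₀)) (-2 * κ l) y := by
        simpa using ((Complex.ofRealCLM.hasDerivAt (x := y)).sub_const (x₀ : ℂ)).const_mul
          (-2 * κ l)
      exact (h1.cexp.const_mul (β l)).congr_deriv (by ring)
    have hdP : ∀ y, (wavePoly (laxData n f g y)).natDegree < n + 1 := fun y => by
      rw [wavePoly_natDegree]; omega
    have hdF : ∀ y, (waveDeriv (laxData n f g y)).natDegree < n + 1 := fun y =>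
      Nat.lt_succ_of_le (natDegree_le_of_degree_le (waveDeriv_degree_lt _).le)
    have hP := fun (z : ℂ) (y : ℝ) (hy : y ∈ I) => (h.hasCoeffDerivAt_wavePoly hy).eval hdP z
    have hF := fun (z : ℂ) (y : ℝ) (hy : y ∈ I) =>
      (h.hasCoeffDerivAt_waveDeriv hI hy).eval hdF z
    -- the defects of the two gluing conditions satisfy `y₁' = y₂`, `y₂' = -v y₁ - 2 κ y₂`
    exact linear_system_eq_zero hc (a := fun _ => 0) (b := fun _ => 1) (c := fun y => -v y)
      (d := fun _ => -2 * κ l)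
      (y₁ := fun y => (wavePoly (laxData n f g y)).eval (-(2 * κ l)) -
        β l * Complex.exp (-2 * κ l * (y - x₀)) * (wavePoly (laxData n f g y)).eval (2 * κ l))
      (y₂ := fun y => (waveDeriv (laxData n f g y)).eval (-(2 * κ l)) -
        β l * Complex.exp (-2 * κ l * (y - x₀)) * ((waveDeriv (laxData n f g y)).eval (2 * κ l) -
          2 * κ l * (wavePoly (laxData n f g y)).eval (2 * κ l)))
      continuousOn_const continuousOn_const (h.continuousOn hI hn).neg continuousOn_const
      (fun y hy => ((hP (-(2 * κ l)) y hy).fun_sub ((hE y).fun_mul (hP (2 * κ l) y hy))).congr_deriv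
        (by ring))
      (fun y hy => ((hF (-(2 * κ l)) y hy).fun_sub ((hE y).fun_mul ((hF (2 * κ l) y hy).fun_sub
        ((hP (2 * κ l) y hy).const_mul (2 * κ l))))).congr_deriv (by
          simp only [eval_sub, eval_mul, eval_X, eval_C]
          ring))
      hx₀ (by simp [h0.1 l]) (by simp [h0.2 l]) hx
  exact ⟨fun l => sub_eq_zero.1 (key l).1, fun l => sub_eq_zero.1 (key l).2⟩

/-! ### The linear system of a soliton as a gluing problem -/

section Bridge

variable {n : ℕ}

/-- The polynomial `∏ j, (X + 2 κ j)` with one factor left out. -/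
def nodePoly (κ : Fin n → ℂ) (l : Fin n) : ℂ[X] :=
  ∏ j ∈ Finset.univ.erase l, (X + C (2 * κ j))

/-- The polynomial `(a + ∑ j, c j ν j / (z / 2 + κ j)) ∏ j, (z + 2 κ j)` in `z`. -/
def solitonPoly (κ c : Fin n → ℂ) (a : ℂ) (ν : Fin n → ℂ) : ℂ[X] :=
  C a * ∏ j, (X + C (2 * κ j)) + ∑ l, C (2 * c l * ν l) * nodePoly κ l

/-- The factor relating the exponentials of the linear system of a soliton to the factors of the
gluing conditions. -/
def glueConst (κ c : Fin n → ℂ) (l : Fin n) : ℂ :=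
  2 * c l * (nodePoly κ l).eval (-(2 * κ l)) / ∏ j, (2 * κ l + 2 * κ j)

/-- The matrix of the linear system `ν l = E l * (a + ∑ j, c j * ν j / (κ l + κ j))`. -/
def cauchyMatrix (κ c E : Fin n → ℂ) : Matrix (Fin n) (Fin n) ℂ :=
  1 - Matrix.of fun l j => E l * (c j / (κ l + κ j))

lemma nodePoly_monic (κ : Fin n → ℂ) (l : Fin n) : (nodePoly κ l).Monic :=
  monic_prod_of_monic _ _ fun _ _ => monic_X_add_C _

lemma nodePoly_natDegree (κ : Fin n → ℂ) (l : Fin n) : (nodePoly κ l).natDegree = n - 1 := by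
  rw [nodePoly, natDegree_prod_of_monic _ _ fun _ _ => monic_X_add_C _,
    Finset.sum_congr rfl fun j _ => natDegree_X_add_C _]
  simp [Finset.card_erase_of_mem]

lemma solitonPoly_sum_degree_lt (κ c ν : Fin n → ℂ) :
    (∑ l, C (2 * c l * ν l) * nodePoly κ l).degree < n := by
  rcases Nat.eq_zero_or_pos n with rfl | hn
  · simp
  refine lt_of_le_of_lt (degree_sum_le _ _) ?_
  refine (Finset.sup_lt_iff (by exact WithBot.bot_lt_coe n)).2 fun l _ => ?_
  refine lt_of_le_of_lt (degree_mul_le _ _) (lt_of_le_of_lt (add_le_add degree_C_le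
    degree_le_natDegree) ?_)
  rw [nodePoly_natDegree, zero_add]
  exact_mod_cast Nat.sub_lt hn one_pos

lemma prod_X_add_C_natDegree (κ : Fin n → ℂ) : (∏ j, (X + C (2 * κ j))).natDegree = n := by
  rw [natDegree_prod_of_monic _ _ fun _ _ => monic_X_add_C _,
    Finset.sum_congr rfl fun j _ => natDegree_X_add_C _]
  simp

lemma prod_X_add_C_monic (κ : Fin n → ℂ) : (∏ j, (X + C (2 * κ j))).Monic :=
  monic_prod_of_monic _ _ fun _ _ => monic_X_add_C _

lemma solitonPoly_coeff (κ c ν : Fin n → ℂ) (a : ℂ) : (solitonPoly κ c a ν).coeff n = a := by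
  have h := (prod_X_add_C_monic κ).coeff_natDegree
  rw [prod_X_add_C_natDegree] at h
  rw [solitonPoly, coeff_add, coeff_C_mul, h,
    coeff_eq_zero_of_degree_lt (solitonPoly_sum_degree_lt κ c ν), mul_one, add_zero]

lemma solitonPoly_natDegree_le (κ c ν : Fin n → ℂ) (a : ℂ) :
    (solitonPoly κ c a ν).natDegree ≤ n := by
  refine (natDegree_add_le _ _).trans (max_le ?_ ?_)
  · exact (natDegree_C_mul_le _ _).trans (prod_X_add_C_natDegree κ).le
  · exact natDegree_le_of_degree_le (solitonPoly_sum_degree_lt κ c ν).le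

lemma solitonPoly_one_natDegree (κ c ν : Fin n → ℂ) : (solitonPoly κ c 1 ν).natDegree = n :=
  natDegree_eq_of_le_of_coeff_ne_zero (solitonPoly_natDegree_le _ _ _ _)
    (by rw [solitonPoly_coeff]; exact one_ne_zero)

lemma solitonPoly_zero_degree_lt (κ c ν : Fin n → ℂ) : (solitonPoly κ c 0 ν).degree < n := by
  simpa [solitonPoly] using solitonPoly_sum_degree_lt κ c ν

lemma solitonPoly_zero_coeff (κ c ν : Fin n → ℂ) :
    (solitonPoly κ c 0 ν).coeff (n - 1) = 2 * ∑ l, c l * ν l := by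
  simp only [solitonPoly, map_zero, zero_mul, zero_add, finsetSum_coeff, coeff_C_mul,
    Finset.mul_sum]
  refine Finset.sum_congr rfl fun l _ => ?_
  have h := (nodePoly_monic κ l).coeff_natDegree
  rw [nodePoly_natDegree] at h
  rw [h]
  ring

variable {κ c : Fin n → ℂ}

lemma eval_nodePoly_of_ne (κ : Fin n → ℂ) {l j : Fin n} (h : j ≠ l) :
    (nodePoly κ j).eval (-(2 * κ l)) = 0 := by
  rw [nodePoly, eval_prod]
  exact Finset.prod_eq_zero (Finset.mem_erase.2 ⟨h.symm, Finset.mem_univ l⟩) (by simp)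

lemma eval_nodePoly_ne_zero (hinj : Function.Injective κ) (l : Fin n) :
    (nodePoly κ l).eval (-(2 * κ l)) ≠ 0 := by
  rw [nodePoly, eval_prod, Finset.prod_ne_zero_iff]
  intro j hj h
  simp only [eval_add, eval_X, eval_C] at h
  exact (Finset.mem_erase.1 hj).1 (hinj (by linear_combination h / 2))

lemma eval_neg_solitonPoly (κ c ν : Fin n → ℂ) (a : ℂ) (l : Fin n) :
    (solitonPoly κ c a ν).eval (-(2 * κ l)) =
      2 * c l * ν l * (nodePoly κ l).eval (-(2 * κ l)) := by
  rw [solitonPoly, eval_add, eval_mul, eval_prod,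
    Finset.prod_eq_zero (Finset.mem_univ l) (by simp), mul_zero, zero_add, eval_finsetSum,
    Finset.sum_eq_single l]
  · simp
  · intro j _ hj
    rw [eval_mul, eval_nodePoly_of_ne κ hj, mul_zero]
  · simp

/-- Evaluation at `2 κ l` produces the right-hand side of the linear system. -/
lemma eval_solitonPoly (hadd : ∀ l j, κ l + κ j ≠ 0) (c ν : Fin n → ℂ) (a : ℂ) (l : Fin n) :
    (solitonPoly κ c a ν).eval (2 * κ l) =
      (∏ j, (2 * κ l + 2 * κ j)) * (a + ∑ j, c j * ν j / (κ l + κ j)) := by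
  have h : ∀ j, (nodePoly κ j).eval (2 * κ l) =
      (∏ j, (2 * κ l + 2 * κ j)) / (2 * κ l + 2 * κ j) := fun j => by
    have hne : 2 * κ l + 2 * κ j ≠ 0 := fun h => hadd l j (by linear_combination h / 2)
    rw [eq_div_iff hne, nodePoly, eval_prod,
      ← Finset.prod_erase_mul _ _ (Finset.mem_univ j)]
    simp
  simp only [solitonPoly, eval_add, eval_mul, eval_prod, eval_C, eval_X, eval_finsetSum, h]
  rw [mul_add, Finset.mul_sum, mul_comm a]
  congr 1
  refine Finset.sum_congr rfl fun j _ => ?_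
  have := hadd l j
  rw [← mul_add]
  field_simp

lemma prod_two_mul_ne_zero (hadd : ∀ l j, κ l + κ j ≠ 0) (l : Fin n) :
    ∏ j, (2 * κ l + 2 * κ j) ≠ 0 :=
  Finset.prod_ne_zero_iff.2 fun j _ h => hadd l j (by linear_combination h / 2)

lemma glueConst_ne_zero (h : SolitonAdmissible κ c) (l : Fin n) : glueConst κ c l ≠ 0 :=
  div_ne_zero (mul_ne_zero (mul_ne_zero two_ne_zero (h.amplitude_ne_zero l))
    (eval_nodePoly_ne_zero h.injective l)) (prod_two_mul_ne_zero h.add_ne_zero l)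

/-- The linear system of a soliton (`a = 1`), or its homogeneous version (`a = 0`), expresses gluing
conditions. -/
lemma isGlued_solitonPoly_iff (h : SolitonAdmissible κ c) {E ν : Fin n → ℂ} {a : ℂ} :
    IsGlued κ (fun l => glueConst κ c l * E l) (solitonPoly κ c a ν) ↔
      ∀ l, ν l = E l * (a + ∑ j, c j * ν j / (κ l + κ j)) := by
  refine forall_congr' fun l => ?_
  have h1 := prod_two_mul_ne_zero h.add_ne_zero l
  have h2 := eval_nodePoly_ne_zero h.injective l
  have h3 := h.amplitude_ne_zero l
  rw [eval_neg_solitonPoly, eval_solitonPoly h.add_ne_zero]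
  simp only [glueConst]
  have e : 2 * c l * (nodePoly κ l).eval (-(2 * κ l)) / (∏ j, (2 * κ l + 2 * κ j)) * E l *
      ((∏ j, (2 * κ l + 2 * κ j)) * (a + ∑ j, c j * ν j / (κ l + κ j))) =
      2 * c l * (nodePoly κ l).eval (-(2 * κ l)) *
        (E l * (a + ∑ j, c j * ν j / (κ l + κ j))) := by
    rw [div_mul_eq_mul_div, div_mul_eq_mul_div, div_eq_iff h1]
    ring
  rw [e, mul_right_comm (2 * c l)]
  exact mul_right_inj' (mul_ne_zero (mul_ne_zero two_ne_zero h3) h2)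

/-- Lagrange interpolation at the points `-2 κ l`. -/
lemma eq_solitonPoly (h : SolitonAdmissible κ c) {Q : ℂ[X]} (hQ : Q.natDegree ≤ n) :
    Q = solitonPoly κ c (Q.coeff n)
      (fun l => Q.eval (-(2 * κ l)) / (2 * c l * (nodePoly κ l).eval (-(2 * κ l)))) := by
  refine eq_of_degree_sub_lt_of_eval_index_eq (s := Finset.univ) (v := fun l => -(2 * κ l)) ?_ ?_ ?_
  · intro l _ j _ hlj
    exact h.injective (by simpa using hlj)
  · rw [Finset.card_univ, Fintype.card_fin]
    refine (degree_lt_iff_coeff_zero _ _).2 fun m hm => ?_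
    rw [coeff_sub]
    rcases hm.eq_or_lt with rfl | hm
    · rw [solitonPoly_coeff, sub_self]
    · rw [coeff_eq_zero_of_natDegree_lt (hQ.trans_lt hm),
        coeff_eq_zero_of_natDegree_lt ((solitonPoly_natDegree_le _ _ _ _).trans_lt hm), sub_zero]
  · intro l _
    have h2 := eval_nodePoly_ne_zero h.injective l
    have h3 := h.amplitude_ne_zero l
    rw [eval_neg_solitonPoly]
    field_simp

lemma cauchyMatrix_mulVec (κ c E ν : Fin n → ℂ) (l : Fin n) :
    (cauchyMatrix κ c E).mulVec ν l = ν l - E l * ∑ j, c j * ν j / (κ l + κ j) := by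
  rw [cauchyMatrix, Matrix.sub_mulVec, Matrix.one_mulVec, Pi.sub_apply, Finset.mul_sum]
  congr 1
  rw [Matrix.mulVec, dotProduct]
  refine Finset.sum_congr rfl fun j _ => ?_
  rw [Matrix.of_apply]
  ring

/-- The linear system is nonsingular exactly when the gluing problem in degrees less than `n` has
only the zero solution. -/
lemma cauchyMatrix_det_ne_zero_iff (h : SolitonAdmissible κ c) {E : Fin n → ℂ} :
    (cauchyMatrix κ c E).det ≠ 0 ↔
      ∀ Q : ℂ[X], Q.degree < n → IsGlued κ (fun l => glueConst κ c l * E l) Q → Q = 0 := by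
  constructor
  · intro hdet Q hQ hglue
    have hQn := natDegree_le_of_degree_le hQ.le
    have e := eq_solitonPoly h hQn
    rw [coeff_eq_zero_of_degree_lt hQ] at e
    set ν : Fin n → ℂ :=
      fun l => Q.eval (-(2 * κ l)) / (2 * c l * (nodePoly κ l).eval (-(2 * κ l)))
    rw [e, isGlued_solitonPoly_iff h] at hglue
    have h0 : ν = 0 := by
      by_contra hν
      refine hdet (Matrix.exists_mulVec_eq_zero_iff.1 ⟨ν, hν, funext fun l => ?_⟩)
      rw [cauchyMatrix_mulVec, Pi.zero_apply, sub_eq_zero, ← zero_add (∑ j, _)]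
      exact hglue l
    rw [e, h0]
    simp [solitonPoly]
  · intro H hdet
    obtain ⟨ν, hν, h0⟩ := Matrix.exists_mulVec_eq_zero_iff.2 hdet
    refine hν (funext fun l => ?_)
    have hQ := H (solitonPoly κ c 0 ν) (solitonPoly_zero_degree_lt κ c ν)
      ((isGlued_solitonPoly_iff h).2 fun l => by
        have := congrFun h0 l
        rw [cauchyMatrix_mulVec, Pi.zero_apply, sub_eq_zero] at this
        rw [zero_add, ← this])
    have := eval_neg_solitonPoly κ c ν 0 l
    rw [hQ, eval_zero, eq_comm, mul_eq_zero, or_iff_left (eval_nodePoly_ne_zero h.injective l),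
      mul_eq_zero, or_iff_right (mul_ne_zero two_ne_zero (h.amplitude_ne_zero l))] at this
    exact this

lemma hasCoeffDerivAt_solitonPoly (κ c : Fin n → ℂ) (a : ℂ) {N : Fin n → ℝ → ℂ} {N' : Fin n → ℂ}
    {x : ℝ} (h : ∀ l, HasDerivAt (N l) (N' l) x) :
    HasCoeffDerivAt (fun y => solitonPoly κ c a (fun l => N l y)) (solitonPoly κ c 0 N') x := by
  have := (HasCoeffDerivAt.const (C a * ∏ j, (X + C (2 * κ j))) x).add
    (HasCoeffDerivAt.sum Finset.univ fun l _ => (HasCoeffDerivAt.C_fun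
      ((h l).const_mul (2 * c l))).mul (HasCoeffDerivAt.const (nodePoly κ l) x))
  simpa [solitonPoly] using this

end Bridge

/-- A family of monic polynomials satisfying the gluing conditions of a soliton yields the soliton
formula, where the `N l` are read off from the values at `-2 κ l`. -/
lemma isSolitonFormula_of_isGluedPair {n : ℕ} {κ θ : Fin n → ℂ} {I : Set ℝ} {v : ℝ → ℂ}
    {P F : ℝ → ℂ[X]} (hκ : SolitonAdmissible κ (fun _ => 1)) (hP : ∀ x, (P x).Monic)
    (hn : ∀ x, (P x).natDegree = n) (hF : ∀ x, (F x).degree < n)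
    (hd : ∀ x ∈ I, HasCoeffDerivAt P (F x) x) (hv : ∀ x ∈ I, v x = (F x).coeff (n - 1))
    (hglue : ∀ x ∈ I, IsGluedPair κ
      (fun l => glueConst κ (fun _ => 1) l * Complex.exp (-2 * κ l * x + θ l)) (P x) (F x)) :
    IsSolitonFormula κ (fun _ => 1) θ I v := by
  set b : Fin n → ℂ := fun l => 2 * (1 : ℂ) * (nodePoly κ l).eval (-(2 * κ l)) with hb
  refine ⟨fun l x => (P x).eval (-(2 * κ l)) / b l, fun x hx => ⟨?_, ?_, ?_⟩⟩
  · refine (cauchyMatrix_det_ne_zero_iff hκ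
      (E := fun l => Complex.exp (-2 * κ l * x + θ l))).2 fun Q hQ hQg => ?_
    exact (hglue x hx).eq_zero hκ.injective hκ.add_ne_zero (hP x) (hn x) (hF x) hQg hQ
  · have e := eq_solitonPoly hκ (hn x).le
    have hg := (hglue x hx).1
    rw [e, isGlued_solitonPoly_iff hκ] at hg
    have hc : (P x).coeff n = 1 := by
      have := (hP x).coeff_natDegree
      rwa [hn] at this
    rw [hc] at hg
    exact hg
  · have hder : ∀ l, deriv (fun y => (P y).eval (-(2 * κ l)) / b l) x =
        (F x).eval (-(2 * κ l)) / b l := fun l =>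
      (((hd x hx).eval (N := n + 1) (fun y => by rw [hn]; omega) _).div_const (b l)).deriv
    have e := eq_solitonPoly hκ (natDegree_le_of_degree_le (hF x).le)
    rw [coeff_eq_zero_of_degree_lt (hF x)] at e
    rw [hv x hx, e, solitonPoly_zero_coeff]
    refine congrArg (2 * ·) (Finset.sum_congr rfl fun l _ => ?_)
    rw [hder]

/-! ### Generic solutions of the constraint are solitons -/

/-- The spectrum `κ` and the gluing factors of a datum outside the exceptional hypersurface. -/
lemma exists_isGluedPair {n : ℕ} {P F : ℂ[X]} (hP : P.Monic) (hn : P.natDegree = n)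
    (hF : F.degree < n) (hsep : (wronskianPoly P F).Separable) (hcop : IsCoprime P F) :
    ∃ κ β : Fin n → ℂ, SolitonAdmissible κ (fun _ => 1) ∧ (∀ l, β l ≠ 0) ∧
      IsGluedPair κ β P F ∧ ∀ z, (wronskianPoly P F).eval z = 0 →
        z = 0 ∨ ∃ j, z = 2 * κ j ∨ z = -(2 * κ j) := by
  obtain ⟨κ, hinj, hadd, hroot, hroots⟩ := exists_spectrum (wronskianPoly_comp_neg P F)
    (wronskianPoly_natDegree hP hn hF) hsep
  choose β hβ h1 h2 using fun l => exists_glue hcop (hroot l)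
  exact ⟨κ, β, ⟨hinj, hadd, fun _ => one_ne_zero⟩, hβ, ⟨h1, h2⟩, hroots⟩

/-- Phases for which the soliton with amplitudes `1` has prescribed gluing factors at `x₀`. -/
lemma exists_phase {n : ℕ} {κ β : Fin n → ℂ} (hκ : SolitonAdmissible κ (fun _ => 1))
    (hβ : ∀ l, β l ≠ 0) (x₀ : ℝ) :
    ∃ θ : Fin n → ℂ,
      ∀ l, glueConst κ (fun _ => 1) l * Complex.exp (-2 * κ l * x₀ + θ l) = β l := by
  refine ⟨fun l => Complex.log (β l / glueConst κ (fun _ => 1) l) + 2 * κ l * x₀, fun l => ?_⟩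
  have h := glueConst_ne_zero hκ l
  rw [show -2 * κ l * x₀ + (Complex.log (β l / glueConst κ (fun _ => 1) l) + 2 * κ l * x₀) =
    Complex.log (β l / glueConst κ (fun _ => 1) l) by ring,
    Complex.exp_log (div_ne_zero (hβ l) h)]
  field_simp

/-- If the gluing factors at one point are those of a soliton, the chain belongs to that soliton on the
whole interval. -/
lemma IsLaxChain.isSolitonFormula {n : ℕ} {I : Set ℝ} {v : ℝ → ℂ} {f g : ℕ → ℝ → ℂ}
    (h : IsLaxChain n I v f g) (hI : IsOpen I) (hc : I.OrdConnected) (hn : 1 ≤ n)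
    {κ θ : Fin n → ℂ} (hκ : SolitonAdmissible κ (fun _ => 1)) {x₀ : ℝ} (hx₀ : x₀ ∈ I)
    (h0 : IsGluedPair κ
      (fun l => glueConst κ (fun _ => 1) l * Complex.exp (-2 * κ l * x₀ + θ l))
      (wavePoly (laxData n f g x₀)) (waveDeriv (laxData n f g x₀))) :
    IsSolitonFormula κ (fun _ => 1) θ I v := by
  refine isSolitonFormula_of_isGluedPair (P := fun x => wavePoly (laxData n f g x))
    (F := fun x => waveDeriv (laxData n f g x)) hκ (fun x => wavePoly_monic _)
    (fun x => wavePoly_natDegree _) (fun x => waveDeriv_degree_lt _)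
    (fun x hx => h.hasCoeffDerivAt_wavePoly hx) (fun x hx => ?_) (fun x hx => ?_)
  · rw [waveDeriv_laxData, ← h.f_one hI hx]
    exact (coeff_descPoly (fun i => f (i + 1) x) (i := 0) hn).symm
  · have e : (fun l => glueConst κ (fun _ => 1) l * Complex.exp (-2 * κ l * x₀ + θ l) *
        Complex.exp (-2 * κ l * (x - x₀))) =
        fun l => glueConst κ (fun _ => 1) l * Complex.exp (-2 * κ l * x + θ l) := by
      funext l
      rw [mul_assoc, ← Complex.exp_add]
      ring_nf
    rw [← e]
    exact h.isGluedPair hI hc hn hx₀ hx h0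

lemma IsLaxChain.isSolitonProfile {n : ℕ} {I : Set ℝ} {v : ℝ → ℂ} {f g : ℕ → ℝ → ℂ}
    (h : IsLaxChain n I v f g) (hI : IsOpen I) (hc : I.OrdConnected) (hn : 1 ≤ n)
    {x₀ : ℝ} (hx₀ : x₀ ∈ I)
    (hD : MvPolynomial.eval (laxData n f g x₀) (discPoly n * resPoly n) ≠ 0) :
    IsSolitonProfile n I v := by
  rw [map_mul, mul_ne_zero_iff, eval_discPoly_ne_zero, eval_resPoly_ne_zero] at hD
  obtain ⟨κ, β, hκ, hβ, hg, -⟩ := exists_isGluedPair (wavePoly_monic _) (wavePoly_natDegree _)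
    (waveDeriv_degree_lt _) hD.1 hD.2
  obtain ⟨θ, hθ⟩ := exists_phase hκ hβ x₀
  refine ⟨κ, fun _ => 1, θ, hκ, h.isSolitonFormula hI hc hn hκ hx₀ ?_⟩
  rwa [funext hθ]

/-- The constraint as an autonomous system of `2 n` first-order equations. -/
def laxField (n : ℕ) (p : Fin n ⊕ Fin n → ℂ) : Fin n ⊕ Fin n → ℂ :=
  Sum.elim (fun i => p (Sum.inr i))
    (fun i => extendSeq (fun j => p (Sum.inr j)) (i + 1) -
      extendSeq (fun j => p (Sum.inr j)) 0 * p (Sum.inl i))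

lemma contDiff_laxField (n : ℕ) : ContDiff ℝ 1 (laxField n) := by
  have hext : ∀ i : ℕ,
      ContDiff ℝ 1 (fun p : Fin n ⊕ Fin n → ℂ => extendSeq (fun j => p (Sum.inr j)) i) := by
    intro i
    unfold extendSeq
    split_ifs
    · exact contDiff_apply ℝ ℂ _
    · exact contDiff_const
  refine contDiff_pi.2 ?_
  rintro (i | i)
  · exact contDiff_apply ℝ ℂ _
  · exact (hext _).sub ((hext 0).mul (contDiff_apply ℝ ℂ _))

/-- Every initial datum belongs to a local solution of the constraint. -/
lemma exists_isLaxChain {n : ℕ} (p : Fin n ⊕ Fin n → ℂ) (x₀ : ℝ) :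
    ∃ ε > 0, ∃ (v : ℝ → ℂ) (f g : ℕ → ℝ → ℂ),
      IsLaxChain n (Set.Ioo (x₀ - ε) (x₀ + ε)) v f g ∧ laxData n f g x₀ = p := by
  obtain ⟨α, h0, ε, hε, hα⟩ :=
    ((contDiff_laxField n).contDiffAt
      (x := p)).exists_forall_mem_closedBall_exists_eq_forall_mem_Ioo_hasDerivAt₀ x₀
  have hα' := fun t ht => hasDerivAt_pi.1 (hα t ht)
  let f : ℕ → ℝ → ℂ := fun i x => match i with
    | 0 => 0
    | i + 1 => extendSeq (fun j => α x (Sum.inr j)) i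
  let g : ℕ → ℝ → ℂ := fun i x => match i with
    | 0 => 1
    | i + 1 => extendSeq (fun j => α x (Sum.inl j)) i
  have hf : ∀ i ≤ n, ∀ x ∈ Set.Ioo (x₀ - ε) (x₀ + ε),
      HasDerivAt (f i) (f (i + 1) x - f 1 x * g i x) x := by
    intro i hi x hx
    rcases i with _ | i
    · simpa [f, g] using hasDerivAt_const x (0 : ℂ)
    · have := hα' x hx (Sum.inr ⟨i, hi⟩)
      simpa only [f, g, extendSeq_of_lt _ (show i < n from hi), laxField, Sum.elim_inr] using this
  refine ⟨ε, hε, f 1, f, g, ⟨fun x _ => rfl, fun x _ => rfl, fun i hi x hx => ?_,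
    fun i hi x hx => (hf i hi x hx).differentiableAt, fun i hi x hx => ?_, fun x _ => ?_⟩, ?_⟩
  · rcases i with _ | i
    · exact hasDerivAt_const x (1 : ℂ)
    · have := hα' x hx (Sum.inl ⟨i, hi⟩)
      simpa only [f, g, extendSeq_of_lt _ (show i < n from hi), laxField, Sum.elim_inl] using this
  · rw [(hf i hi x hx).deriv]
    ring
  · exact dif_neg (lt_irrefl n)
  · funext i
    rcases i with i | i <;> simp [laxData, f, g, extendSeq, h0]

/-! ### Partial derivatives of smooth functions of two variables -/

/-- The partial derivative in the first variable. -/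
def partialX (G : ℝ × ℝ → ℂ) (p : ℝ × ℝ) : ℂ := fderiv ℝ G p (1, 0)

/-- The partial derivative in the second variable. -/
def partialT (G : ℝ × ℝ → ℂ) (p : ℝ × ℝ) : ℂ := fderiv ℝ G p (0, 1)

section Partial

variable {Ω : Set (ℝ × ℝ)} {G : ℝ × ℝ → ℂ}

lemma contDiffOn_partialX (hΩ : IsOpen Ω) (hG : ContDiffOn ℝ ∞ G Ω) :
    ContDiffOn ℝ ∞ (partialX G) Ω :=
  (hG.fderiv_of_isOpen hΩ (by simp)).clm_apply contDiffOn_const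

lemma contDiffOn_partialT (hΩ : IsOpen Ω) (hG : ContDiffOn ℝ ∞ G Ω) :
    ContDiffOn ℝ ∞ (partialT G) Ω :=
  (hG.fderiv_of_isOpen hΩ (by simp)).clm_apply contDiffOn_const

lemma differentiableAt_of_contDiffOn (hΩ : IsOpen Ω) (hG : ContDiffOn ℝ ∞ G Ω) {p : ℝ × ℝ}
    (hp : p ∈ Ω) : DifferentiableAt ℝ G p :=
  (hG.contDiffAt (hΩ.mem_nhds hp)).differentiableAt (by simp)

lemma hasDerivAt_partialX (hΩ : IsOpen Ω) (hG : ContDiffOn ℝ ∞ G Ω) {x t : ℝ}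
    (hp : (x, t) ∈ Ω) : HasDerivAt (fun y => G (y, t)) (partialX G (x, t)) x :=
  (differentiableAt_of_contDiffOn hΩ hG hp).hasFDerivAt.comp_hasDerivAt x
    ((hasDerivAt_id x).prodMk (hasDerivAt_const x t))

lemma hasDerivAt_partialT (hΩ : IsOpen Ω) (hG : ContDiffOn ℝ ∞ G Ω) {x t : ℝ}
    (hp : (x, t) ∈ Ω) : HasDerivAt (fun s => G (x, s)) (partialT G (x, t)) t :=
  (differentiableAt_of_contDiffOn hΩ hG hp).hasFDerivAt.comp_hasDerivAt t
    ((hasDerivAt_const t x).prodMk (hasDerivAt_id t))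

lemma partialX_partialT (hΩ : IsOpen Ω) (hG : ContDiffOn ℝ ∞ G Ω) {p : ℝ × ℝ} (hp : p ∈ Ω) :
    partialX (partialT G) p = partialT (partialX G) p := by
  have hC := hG.contDiffAt (hΩ.mem_nhds hp)
  have hs : IsSymmSndFDerivAt ℝ G p := hC.isSymmSndFDerivAt (by
    simpa using WithTop.coe_le_coe.2 (le_top : (2 : ℕ∞) ≤ ⊤))
  have hd : DifferentiableAt ℝ (fderiv ℝ G) p :=
    (hC.fderiv_right (m := ∞) (by simp)).differentiableAt (by simp)
  have e : ∀ v w : ℝ × ℝ, fderiv ℝ (fun q => fderiv ℝ G q v) p w = fderiv ℝ (fderiv ℝ G) p w v := by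
    intro v w
    rw [fderiv_clm_apply hd (differentiableAt_const v)]
    simp
  exact (e _ _).trans ((hs _ _).trans (e _ _).symm)

lemma hasDerivAt_partialT_x (hΩ : IsOpen Ω) (hG : ContDiffOn ℝ ∞ G Ω) {x t : ℝ}
    (hp : (x, t) ∈ Ω) :
    HasDerivAt (fun y => partialT G (y, t)) (partialT (partialX G) (x, t)) x := by
  rw [← partialX_partialT hΩ hG hp]
  exact hasDerivAt_partialX hΩ (contDiffOn_partialT hΩ hG) hp

end Partial

lemma deriv_eq_of_eqOn {I : Set ℝ} (hI : IsOpen I) {h k : ℝ → ℂ} {k' : ℂ} {x : ℝ} (hx : x ∈ I)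
    (hk : HasDerivAt k k' x) (e : ∀ y ∈ I, h y = k y) : deriv h x = k' := by
  refine (hk.congr_of_eventuallyEq ?_).deriv
  filter_upwards [hI.mem_nhds hx] with y hy using e y hy

lemma iteratedDeriv_three_eq {I : Set ℝ} (hI : IsOpen I) {h h₀ h₁ h₂ h₃ : ℝ → ℂ}
    (e : ∀ y ∈ I, h y = h₀ y) (d₁ : ∀ y ∈ I, HasDerivAt h₀ (h₁ y) y)
    (d₂ : ∀ y ∈ I, HasDerivAt h₁ (h₂ y) y) (d₃ : ∀ y ∈ I, HasDerivAt h₂ (h₃ y) y) {x : ℝ}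
    (hx : x ∈ I) : iteratedDeriv 3 h x = h₃ x := by
  have e1 : ∀ y ∈ I, iteratedDeriv 1 h y = h₁ y := fun y hy => by
    rw [iteratedDeriv_one]
    exact deriv_eq_of_eqOn hI hy (d₁ y hy) e
  have e2 : ∀ y ∈ I, iteratedDeriv 2 h y = h₂ y := fun y hy => by
    rw [iteratedDeriv_succ]
    exact deriv_eq_of_eqOn hI hy (d₂ y hy) e1
  rw [iteratedDeriv_succ]
  exact deriv_eq_of_eqOn hI hx (d₃ x hx) e2

/-! ### The functions of a soliton -/

section Soliton

variable {n : ℕ}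

/-- The exponentials `exp (-2 κ l x + θ l + η l t)`. -/
def solitonExp (κ θ η : Fin n → ℂ) (p : ℝ × ℝ) (l : Fin n) : ℂ :=
  Complex.exp (-2 * κ l * p.1 + θ l + η l * p.2)

/-- The solution of the linear system of a soliton by Cramer's rule, where the phases `θ l + η l t`
move linearly with arbitrary velocities. -/
def solitonN (κ c θ η : Fin n → ℂ) (l : Fin n) (p : ℝ × ℝ) : ℂ :=
  (cauchyMatrix κ c (solitonExp κ θ η p)).cramer (solitonExp κ θ η p) l /
    (cauchyMatrix κ c (solitonExp κ θ η p)).det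

variable {κ c θ η : Fin n → ℂ}

lemma eq_solitonN_iff {p : ℝ × ℝ} (hdet : (cauchyMatrix κ c (solitonExp κ θ η p)).det ≠ 0)
    (ν : Fin n → ℂ) :
    (∀ l, ν l = solitonExp κ θ η p l * (1 + ∑ j, c j * ν j / (κ l + κ j))) ↔
      ∀ l, ν l = solitonN κ c θ η l p := by
  have h1 : (∀ l, ν l = solitonExp κ θ η p l * (1 + ∑ j, c j * ν j / (κ l + κ j))) ↔
      (cauchyMatrix κ c (solitonExp κ θ η p)).mulVec ν = solitonExp κ θ η p := by
    rw [funext_iff]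
    refine forall_congr' fun l => ?_
    rw [cauchyMatrix_mulVec, sub_eq_iff_eq_add, mul_add, mul_one]
  have h2 : (cauchyMatrix κ c (solitonExp κ θ η p)).mulVec (fun l => solitonN κ c θ η l p) =
      solitonExp κ θ η p := by
    have e : (fun l => solitonN κ c θ η l p) =
        (cauchyMatrix κ c (solitonExp κ θ η p)).det⁻¹ •
          (cauchyMatrix κ c (solitonExp κ θ η p)).cramer (solitonExp κ θ η p) := by
      funext l
      simp [solitonN, div_eq_inv_mul]
    rw [e, Matrix.mulVec_smul, Matrix.mulVec_cramer, smul_smul, inv_mul_cancel₀ hdet, one_smul]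
  rw [h1, ← funext_iff]
  constructor
  · intro h
    exact Matrix.mulVec_injective_of_isUnit
      ((Matrix.isUnit_iff_isUnit_det _).2 (IsUnit.mk0 _ hdet)) (h.trans h2.symm)
  · rintro rfl
    exact h2

lemma contDiff_solitonExp (κ θ η : Fin n → ℂ) (l : Fin n) :
    ContDiff ℝ ∞ (fun p => solitonExp κ θ η p l) := by
  unfold solitonExp
  have h1 : ContDiff ℝ ∞ (fun p : ℝ × ℝ => (p.1 : ℂ)) :=
    Complex.ofRealCLM.contDiff.comp contDiff_fst
  have h2 : ContDiff ℝ ∞ (fun p : ℝ × ℝ => (p.2 : ℂ)) :=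
    Complex.ofRealCLM.contDiff.comp contDiff_snd
  exact (((contDiff_const.mul h1).add contDiff_const).add (contDiff_const.mul h2)).cexp

lemma contDiff_det {A : ℝ × ℝ → Matrix (Fin n) (Fin n) ℂ}
    (h : ∀ i j, ContDiff ℝ ∞ (fun p => A p i j)) : ContDiff ℝ ∞ (fun p => (A p).det) := by
  simp only [Matrix.det_apply]
  refine ContDiff.sum fun σ _ => ?_
  exact (contDiff_prod fun i _ => h _ _).const_smul _

lemma contDiff_cauchyMatrix (κ c θ η : Fin n → ℂ) (i j : Fin n) :
    ContDiff ℝ ∞ (fun p => cauchyMatrix κ c (solitonExp κ θ η p) i j) := by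
  simp only [cauchyMatrix, Matrix.sub_apply, Matrix.of_apply]
  exact contDiff_const.sub ((contDiff_solitonExp κ θ η i).mul contDiff_const)

lemma contDiffOn_solitonN {Ω : Set (ℝ × ℝ)}
    (hdet : ∀ p ∈ Ω, (cauchyMatrix κ c (solitonExp κ θ η p)).det ≠ 0) (l : Fin n) :
    ContDiffOn ℝ ∞ (solitonN κ c θ η l) Ω := by
  unfold solitonN
  simp only [div_eq_mul_inv]
  refine ContDiffOn.mul ?_ ((contDiff_det (contDiff_cauchyMatrix κ c θ η)).contDiffOn.inv hdet)
  simp only [Matrix.cramer_apply]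
  refine (contDiff_det fun i j => ?_).contDiffOn
  simp only [Matrix.updateCol_apply]
  split_ifs
  · exact contDiff_solitonExp κ θ η i
  · exact contDiff_cauchyMatrix κ c θ η i j

/-- The polynomial of a soliton. -/
def solitonP (κ c θ η : Fin n → ℂ) (p : ℝ × ℝ) : ℂ[X] :=
  solitonPoly κ c 1 (fun l => solitonN κ c θ η l p)

/-- The image of the polynomial of a soliton under a differential operator `D` annihilating the
constants. -/
def solitonD (κ c θ η : Fin n → ℂ) (D : (ℝ × ℝ → ℂ) → ℝ × ℝ → ℂ) (p : ℝ × ℝ) : ℂ[X] :=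
  solitonPoly κ c 0 (fun l => D (solitonN κ c θ η l) p)

/-- An open set of the `(x, t)`-plane on which the linear system of a soliton is nonsingular. -/
structure IsSolitonRegion (κ c θ η : Fin n → ℂ) (Ω : Set (ℝ × ℝ)) : Prop where
  admissible : SolitonAdmissible κ c
  isOpen : IsOpen Ω
  det_ne_zero : ∀ p ∈ Ω, (cauchyMatrix κ c (solitonExp κ θ η p)).det ≠ 0

namespace IsSolitonRegion

variable {Ω : Set (ℝ × ℝ)} {x t : ℝ}

lemma contDiffOn (h : IsSolitonRegion κ c θ η Ω) (l : Fin n) :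
    ContDiffOn ℝ ∞ (solitonN κ c θ η l) Ω :=
  contDiffOn_solitonN h.det_ne_zero l

lemma hasCoeffDerivAt_x (h : IsSolitonRegion κ c θ η Ω) (hp : (x, t) ∈ Ω) :
    HasCoeffDerivAt (fun y => solitonP κ c θ η (y, t)) (solitonD κ c θ η partialX (x, t)) x :=
  hasCoeffDerivAt_solitonPoly κ c 1 (N := fun l y => solitonN κ c θ η l (y, t))
    fun l => hasDerivAt_partialX h.isOpen (h.contDiffOn l) hp

lemma hasCoeffDerivAt_t (h : IsSolitonRegion κ c θ η Ω) (hp : (x, t) ∈ Ω) :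
    HasCoeffDerivAt (fun s => solitonP κ c θ η (x, s)) (solitonD κ c θ η partialT (x, t)) t :=
  hasCoeffDerivAt_solitonPoly κ c 1 (N := fun l s => solitonN κ c θ η l (x, s))
    fun l => hasDerivAt_partialT h.isOpen (h.contDiffOn l) hp

lemma hasCoeffDerivAt_D_x (h : IsSolitonRegion κ c θ η Ω) {D : (ℝ × ℝ → ℂ) → ℝ × ℝ → ℂ}
    (hD : ∀ l, ContDiffOn ℝ ∞ (D (solitonN κ c θ η l)) Ω) (hp : (x, t) ∈ Ω) :
    HasCoeffDerivAt (fun y => solitonD κ c θ η D (y, t))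
      (solitonD κ c θ η (fun G => partialX (D G)) (x, t)) x :=
  hasCoeffDerivAt_solitonPoly κ c 0 (N := fun l y => D (solitonN κ c θ η l) (y, t))
    fun l => hasDerivAt_partialX h.isOpen (hD l) hp

lemma hasCoeffDerivAt_D_t (h : IsSolitonRegion κ c θ η Ω) {D : (ℝ × ℝ → ℂ) → ℝ × ℝ → ℂ}
    (hD : ∀ l, ContDiffOn ℝ ∞ (D (solitonN κ c θ η l)) Ω) (hp : (x, t) ∈ Ω) :
    HasCoeffDerivAt (fun s => solitonD κ c θ η D (x, s))
      (solitonD κ c θ η (fun G => partialT (D G)) (x, t)) t :=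
  hasCoeffDerivAt_solitonPoly κ c 0 (N := fun l s => D (solitonN κ c θ η l) (x, s))
    fun l => hasDerivAt_partialT h.isOpen (hD l) hp

end IsSolitonRegion

end Soliton

lemma eq_mul_of_hasDerivAt {m p b : ℝ → ℂ} {m' p' μ : ℂ} {x : ℝ} (hm : HasDerivAt m m' x)
    (hp : HasDerivAt p p' x) (hb : HasDerivAt b (μ * b x) x)
    (e : ∀ᶠ y in nhds x, m y = b y * p y) : m' = b x * (p' + μ * p x) := by
  have := hm.unique ((hb.fun_mul hp).congr_of_eventuallyEq e)
  rw [this]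
  ring

section

variable {n : ℕ} {κ c θ η : Fin n → ℂ}

lemma solitonD_degree_lt (κ c θ η : Fin n → ℂ) (D : (ℝ × ℝ → ℂ) → ℝ × ℝ → ℂ) (p : ℝ × ℝ) :
    (solitonD κ c θ η D p).degree < n := solitonPoly_zero_degree_lt _ _ _

lemma solitonD_natDegree_lt (κ c θ η : Fin n → ℂ) (D : (ℝ × ℝ → ℂ) → ℝ × ℝ → ℂ) (p : ℝ × ℝ) :
    (solitonD κ c θ η D p).natDegree < n + 1 :=
  Nat.lt_succ_of_le (natDegree_le_of_degree_le (solitonD_degree_lt κ c θ η D p).le)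

lemma solitonP_natDegree_lt (κ c θ η : Fin n → ℂ) (p : ℝ × ℝ) :
    (solitonP κ c θ η p).natDegree < n + 1 :=
  Nat.lt_succ_of_le (solitonPoly_one_natDegree _ _ _).le

/-- The gluing factors of a soliton. -/
def solitonGlue (κ c θ η : Fin n → ℂ) (p : ℝ × ℝ) (l : Fin n) : ℂ :=
  glueConst κ c l * solitonExp κ θ η p l

lemma hasDerivAt_solitonGlue_x (κ c θ η : Fin n → ℂ) (l : Fin n) (x t : ℝ) :
    HasDerivAt (fun y => solitonGlue κ c θ η (y, t) l)
      (-2 * κ l * solitonGlue κ c θ η (x, t) l) x := by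
  have h1 : HasDerivAt (fun y : ℝ => -2 * κ l * (y : ℂ) + θ l + η l * t) (-2 * κ l) x := by
    simpa using (((Complex.ofRealCLM.hasDerivAt (x := x)).const_mul
      (-2 * κ l)).add_const (θ l)).add_const (η l * t)
  exact (h1.cexp.const_mul (glueConst κ c l)).congr_deriv (by
    simp only [solitonGlue, solitonExp]; ring)

lemma hasDerivAt_solitonGlue_t (κ c θ η : Fin n → ℂ) (l : Fin n) (x t : ℝ) :
    HasDerivAt (fun s => solitonGlue κ c θ η (x, s) l)
      (η l * solitonGlue κ c θ η (x, t) l) t := by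
  have h1 : HasDerivAt (fun s : ℝ => -2 * κ l * (x : ℂ) + θ l + η l * s) (η l) t := by
    simpa using ((Complex.ofRealCLM.hasDerivAt (x := t)).const_mul
      (η l)).const_add (-2 * κ l * (x : ℂ) + θ l)
  exact (h1.cexp.const_mul (glueConst κ c l)).congr_deriv (by
    simp only [solitonGlue, solitonExp]; ring)

/-- The potential `2 ∑ j, c j ∂ₓ (N j)` of a soliton. -/
def solitonU (κ c θ η : Fin n → ℂ) (p : ℝ × ℝ) : ℂ :=
  2 * ∑ j, c j * partialX (solitonN κ c θ η j) p

lemma solitonD_partialX_coeff (κ c θ η : Fin n → ℂ) (p : ℝ × ℝ) :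
    (solitonD κ c θ η partialX p).coeff (n - 1) = solitonU κ c θ η p :=
  solitonPoly_zero_coeff _ _ _

end

namespace IsSolitonRegion

variable {n : ℕ} {κ c θ η : Fin n → ℂ} {Ω : Set (ℝ × ℝ)} {x t : ℝ}

lemma eventually_x (h : IsSolitonRegion κ c θ η Ω) (hp : (x, t) ∈ Ω) :
    ∀ᶠ y in nhds x, (y, t) ∈ Ω :=
  (Continuous.prodMk_left t).continuousAt.eventually (h.isOpen.mem_nhds hp)

lemma eventually_t (h : IsSolitonRegion κ c θ η Ω) (hp : (x, t) ∈ Ω) :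
    ∀ᶠ s in nhds t, (x, s) ∈ Ω :=
  (Continuous.prodMk_right x).continuousAt.eventually (h.isOpen.mem_nhds hp)

lemma isGlued (h : IsSolitonRegion κ c θ η Ω) {p : ℝ × ℝ} (hp : p ∈ Ω) :
    IsGlued κ (solitonGlue κ c θ η p) (solitonP κ c θ η p) :=
  (isGlued_solitonPoly_iff h.admissible).2
    ((eq_solitonN_iff (h.det_ne_zero p hp) _).2 fun _ => rfl)

lemma eq_zero_of_isGlued (h : IsSolitonRegion κ c θ η Ω) {p : ℝ × ℝ} (hp : p ∈ Ω) {Q : ℂ[X]}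
    (hQ : Q.degree < n) (hg : IsGlued κ (solitonGlue κ c θ η p) Q) : Q = 0 :=
  (cauchyMatrix_det_ne_zero_iff h.admissible).1 (h.det_ne_zero p hp) Q hQ hg

lemma contDiffOn_X (h : IsSolitonRegion κ c θ η Ω) (l : Fin n) :
    ContDiffOn ℝ ∞ (partialX (solitonN κ c θ η l)) Ω :=
  contDiffOn_partialX h.isOpen (h.contDiffOn l)

lemma contDiffOn_XX (h : IsSolitonRegion κ c θ η Ω) (l : Fin n) :
    ContDiffOn ℝ ∞ (partialX (partialX (solitonN κ c θ η l))) Ω :=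
  contDiffOn_partialX h.isOpen (h.contDiffOn_X l)

lemma contDiffOn_XXX (h : IsSolitonRegion κ c θ η Ω) (l : Fin n) :
    ContDiffOn ℝ ∞ (partialX (partialX (partialX (solitonN κ c θ η l)))) Ω :=
  contDiffOn_partialX h.isOpen (h.contDiffOn_XX l)

lemma contDiffOn_solitonU (h : IsSolitonRegion κ c θ η Ω) :
    ContDiffOn ℝ ∞ (solitonU κ c θ η) Ω :=
  contDiffOn_const.mul (ContDiffOn.sum fun l _ => contDiffOn_const.mul (h.contDiffOn_X l))

/-- The gluing conditions differentiated once in `x`. -/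
lemma eval_X (h : IsSolitonRegion κ c θ η Ω) (hp : (x, t) ∈ Ω) (l : Fin n) :
    (solitonD κ c θ η partialX (x, t)).eval (-(2 * κ l)) = solitonGlue κ c θ η (x, t) l *
      ((solitonD κ c θ η partialX (x, t)).eval (2 * κ l) +
        -2 * κ l * (solitonP κ c θ η (x, t)).eval (2 * κ l)) := by
  have hd := (h.hasCoeffDerivAt_x hp).eval (fun y => solitonP_natDegree_lt κ c θ η (y, t))
  refine eq_mul_of_hasDerivAt (hd _) (hd _) (hasDerivAt_solitonGlue_x κ c θ η l x t) ?_
  filter_upwards [h.eventually_x hp] with y hy using h.isGlued hy l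

/-- The gluing conditions differentiated twice in `x`. -/
lemma eval_XX (h : IsSolitonRegion κ c θ η Ω) (hp : (x, t) ∈ Ω) (l : Fin n) :
    (solitonD κ c θ η (fun G => partialX (partialX G)) (x, t)).eval (-(2 * κ l)) =
      solitonGlue κ c θ η (x, t) l *
      ((solitonD κ c θ η (fun G => partialX (partialX G)) (x, t)).eval (2 * κ l) +
        -2 * κ l * (solitonD κ c θ η partialX (x, t)).eval (2 * κ l) +
        -2 * κ l * ((solitonD κ c θ η partialX (x, t)).eval (2 * κ l) +
          -2 * κ l * (solitonP κ c θ η (x, t)).eval (2 * κ l))) := by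
  have hd := (h.hasCoeffDerivAt_x hp).eval (fun y => solitonP_natDegree_lt κ c θ η (y, t))
  have hd2 := (h.hasCoeffDerivAt_D_x h.contDiffOn_X hp).eval
    (fun y => solitonD_natDegree_lt κ c θ η partialX (y, t))
  refine eq_mul_of_hasDerivAt (hd2 _) ((hd2 _).fun_add ((hd _).const_mul (-2 * κ l)))
    (hasDerivAt_solitonGlue_x κ c θ η l x t) ?_
  filter_upwards [h.eventually_x hp] with y hy using h.eval_X hy l

/-- The gluing conditions differentiated in `t`. -/
lemma eval_T (h : IsSolitonRegion κ c θ η Ω) (hp : (x, t) ∈ Ω) (l : Fin n) :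
    (solitonD κ c θ η partialT (x, t)).eval (-(2 * κ l)) = solitonGlue κ c θ η (x, t) l *
      ((solitonD κ c θ η partialT (x, t)).eval (2 * κ l) +
        η l * (solitonP κ c θ η (x, t)).eval (2 * κ l)) := by
  have hd := (h.hasCoeffDerivAt_t hp).eval (fun s => solitonP_natDegree_lt κ c θ η (x, s))
  refine eq_mul_of_hasDerivAt (hd _) (hd _) (hasDerivAt_solitonGlue_t κ c θ η l x t) ?_
  filter_upwards [h.eventually_t hp] with s hs using h.isGlued hs l

/-- The equation `P'' - X P' + u P = 0` of a soliton: its left-hand side has degree less than `n` and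
satisfies the gluing conditions. -/
lemma solitonD_XX (h : IsSolitonRegion κ c θ η Ω) (hn : 1 ≤ n) (hp : (x, t) ∈ Ω) :
    solitonD κ c θ η (fun G => partialX (partialX G)) (x, t) =
      X * solitonD κ c θ η partialX (x, t) -
        C (solitonU κ c θ η (x, t)) * solitonP κ c θ η (x, t) := by
  rw [← sub_eq_zero]
  refine h.eq_zero_of_isGlued hp ?_ fun l => ?_
  · refine (degree_lt_iff_coeff_zero _ _).2 fun m hm => ?_
    have h1 := coeff_eq_zero_of_degree_lt ((solitonD_degree_lt κ c θ η
      (fun G => partialX (partialX G)) (x, t)).trans_le (by exact_mod_cast hm))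
    obtain ⟨k, rfl⟩ : ∃ k, m = k + 1 := ⟨m - 1, by omega⟩
    rw [coeff_sub, coeff_sub, h1, coeff_X_mul, coeff_C_mul]
    rcases hm.eq_or_lt with rfl | hm
    · have h2 : (solitonP κ c θ η (x, t)).coeff (k + 1) = 1 := solitonPoly_coeff _ _ _ _
      have h3 := solitonD_partialX_coeff κ c θ η (x, t)
      rw [Nat.add_sub_cancel] at h3
      rw [h2, h3]
      ring
    · have h2 := coeff_eq_zero_of_natDegree_lt
        ((solitonP_natDegree_lt κ c θ η (x, t)).trans_le (show n + 1 ≤ k + 1 by omega))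
      have h3 := coeff_eq_zero_of_degree_lt ((solitonD_degree_lt κ c θ η partialX (x, t)).trans_le
        (show (n : WithBot ℕ) ≤ (k : WithBot ℕ) by exact_mod_cast (by omega : n ≤ k)))
      rw [h2, h3]
      ring
  · simp only [eval_sub, eval_mul, Polynomial.eval_X, eval_C, h.eval_XX hp l, h.eval_X hp l,
      h.isGlued hp l]
    ring

lemma hasDerivAt_solitonU (h : IsSolitonRegion κ c θ η Ω) (hp : (x, t) ∈ Ω) :
    HasDerivAt (fun y => solitonU κ c θ η (y, t)) (partialX (solitonU κ c θ η) (x, t)) x :=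
  hasDerivAt_partialX h.isOpen h.contDiffOn_solitonU hp

lemma solitonD_XXX (h : IsSolitonRegion κ c θ η Ω) (hn : 1 ≤ n) (hp : (x, t) ∈ Ω) :
    solitonD κ c θ η (fun G => partialX (partialX (partialX G))) (x, t) =
      X * solitonD κ c θ η (fun G => partialX (partialX G)) (x, t) -
        (C (partialX (solitonU κ c θ η) (x, t)) * solitonP κ c θ η (x, t) +
        C (solitonU κ c θ η (x, t)) * solitonD κ c θ η partialX (x, t)) := by
  have h1 := h.hasCoeffDerivAt_D_x (D := fun G => partialX (partialX G)) h.contDiffOn_XX hp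
  have h2 := ((h.hasCoeffDerivAt_D_x h.contDiffOn_X hp).const_mul X).sub
    ((HasCoeffDerivAt.C_fun (h.hasDerivAt_solitonU hp)).mul (h.hasCoeffDerivAt_x hp))
  refine h1.unique (h2.congr (I := (fun y => (y, t)) ⁻¹' Ω)
    (h.isOpen.preimage (Continuous.prodMk_left t)) hp fun y hy => h.solitonD_XX hn hy)

/-- The evolution `P_t = P_xxx + 3 u P_x` of a soliton with the KdV phase velocities. In this form the
difference of both sides visibly has degree less than `n`; by `solitonD_XX` and `solitonD_XXX` it
equals `P_t - (X² + 2 u) P_x + (X u + u_x) P`, which satisfies the gluing conditions. -/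
lemma solitonD_T (h : IsSolitonRegion κ c θ (fun l => -8 * κ l ^ 3) Ω) (hn : 1 ≤ n)
    (hp : (x, t) ∈ Ω) :
    solitonD κ c θ (fun l => -8 * κ l ^ 3) partialT (x, t) =
      solitonD κ c θ (fun l => -8 * κ l ^ 3) (fun G => partialX (partialX (partialX G))) (x, t) +
        C (3 * solitonU κ c θ (fun l => -8 * κ l ^ 3) (x, t)) *
          solitonD κ c θ (fun l => -8 * κ l ^ 3) partialX (x, t) := by
  rw [← sub_eq_zero]
  refine h.eq_zero_of_isGlued hp ?_ fun l => ?_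
  · refine (degree_sub_le _ _).trans_lt (max_lt (solitonD_degree_lt _ _ _ _ _ _)
      ((degree_add_le _ _).trans_lt (max_lt (solitonD_degree_lt _ _ _ _ _ _) ?_)))
    rw [← smul_eq_C_mul]
    exact (degree_smul_le _ _).trans_lt (solitonD_degree_lt _ _ _ _ _ _)
  · rw [h.solitonD_XXX hn hp, h.solitonD_XX hn hp]
    simp only [eval_sub, eval_add, eval_mul, Polynomial.eval_X, eval_C, h.eval_T hp l,
      h.eval_X hp l, h.isGlued hp l]
    ring

end IsSolitonRegion

/-! ### Solitons satisfy the constraint and the KdV equation -/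

section

variable {n : ℕ}

/-- The functions `g i` of the constraint for a soliton. -/
def solitonChainG (κ c θ η : Fin n → ℂ) (i : ℕ) (p : ℝ × ℝ) : ℂ :=
  (solitonP κ c θ η p).coeff (n - i)

/-- The functions `f i` of the constraint for a soliton. -/
def solitonChainF (κ c θ η : Fin n → ℂ) (i : ℕ) (p : ℝ × ℝ) : ℂ :=
  if i ≤ n then (solitonD κ c θ η partialX p).coeff (n - i) else 0

variable {κ c θ η : Fin n → ℂ}

lemma solitonMatrix_eq (κ c θ η : Fin n → ℂ) (x t : ℝ) :
    solitonMatrix κ c (fun l => θ l + η l * t) x = cauchyMatrix κ c (solitonExp κ θ η (x, t)) := by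
  simp only [solitonMatrix, cauchyMatrix, solitonExp, add_assoc]

namespace IsSolitonRegion

variable {Ω : Set (ℝ × ℝ)} {I J : Set ℝ} {x t : ℝ}

lemma isLaxChain (h : IsSolitonRegion κ c θ η (I ×ˢ J)) (hn : 1 ≤ n) (ht : t ∈ J) {v : ℝ → ℂ}
    (hv : ∀ x ∈ I, v x = solitonU κ c θ η (x, t)) :
    IsLaxChain n I v (fun i x => solitonChainF κ c θ η i (x, t))
      (fun i x => solitonChainG κ c θ η i (x, t)) := by
  have hf : ∀ i ≤ n, ∀ x ∈ I, HasDerivAt (fun y => solitonChainF κ c θ η i (y, t))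
      (solitonChainF κ c θ η (i + 1) (x, t) - v x * solitonChainG κ c θ η i (x, t)) x := by
    intro i hi x hx
    have hp : (x, t) ∈ I ×ˢ J := ⟨hx, ht⟩
    have h1 := h.hasCoeffDerivAt_D_x h.contDiffOn_X hp (n - i)
    rw [h.solitonD_XX hn hp, coeff_sub, coeff_C_mul, ← hv x hx] at h1
    simp only [solitonChainF, if_pos hi, solitonChainG]
    refine h1.congr_deriv ?_
    congr 1
    split_ifs with hi'
    · rw [show n - i = n - (i + 1) + 1 by omega, coeff_X_mul]
    · rw [show n - i = 0 by omega, coeff_X_mul_zero]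
  refine ⟨fun x _ => ?_, fun x _ => ?_, fun i hi x hx => ?_,
    fun i hi x hx => (hf i hi x hx).differentiableAt, fun i hi x hx => ?_, fun x _ => ?_⟩
  · simp only [solitonChainF, if_pos (Nat.zero_le n), Nat.sub_zero]
    exact coeff_eq_zero_of_degree_lt (solitonD_degree_lt _ _ _ _ _ _)
  · exact solitonPoly_coeff _ _ _ _
  · simp only [solitonChainF, if_pos hi]
    exact h.hasCoeffDerivAt_x (show (x, t) ∈ I ×ˢ J from ⟨hx, ht⟩) (n - i)
  · rw [(hf i hi x hx).deriv]
    ring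
  · exact if_neg (by omega)

lemma contDiffOn_solitonChainG (h : IsSolitonRegion κ c θ η Ω) (i : ℕ) :
    ContDiffOn ℝ ∞ (solitonChainG κ c θ η i) Ω := by
  unfold solitonChainG solitonP solitonPoly
  simp only [coeff_add, finsetSum_coeff, coeff_C_mul]
  exact contDiffOn_const.add (ContDiffOn.sum fun l _ =>
    (contDiffOn_const.mul (h.contDiffOn l)).mul contDiffOn_const)

/-- The evolution of the `x`-derivative of `P`. -/
lemma solitonD_TX (h : IsSolitonRegion κ c θ (fun l => -8 * κ l ^ 3) Ω) (hn : 1 ≤ n)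
    (hp : (x, t) ∈ Ω) :
    solitonD κ c θ (fun l => -8 * κ l ^ 3) (fun G => partialT (partialX G)) (x, t) =
      solitonD κ c θ (fun l => -8 * κ l ^ 3)
        (fun G => partialX (partialX (partialX (partialX G)))) (x, t) +
      (C (3 * partialX (solitonU κ c θ fun l => -8 * κ l ^ 3) (x, t)) *
          solitonD κ c θ (fun l => -8 * κ l ^ 3) partialX (x, t) +
        C (3 * solitonU κ c θ (fun l => -8 * κ l ^ 3) (x, t)) *
          solitonD κ c θ (fun l => -8 * κ l ^ 3) (fun G => partialX (partialX G)) (x, t)) := by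
  have h1 : HasCoeffDerivAt (fun y => solitonD κ c θ (fun l => -8 * κ l ^ 3) partialT (y, t))
      (solitonD κ c θ (fun l => -8 * κ l ^ 3) (fun G => partialT (partialX G)) (x, t)) x :=
    hasCoeffDerivAt_solitonPoly κ c 0
      fun l => hasDerivAt_partialT_x h.isOpen (h.contDiffOn l) hp
  have h2 := (h.hasCoeffDerivAt_D_x (D := fun G => partialX (partialX (partialX G)))
    h.contDiffOn_XXX hp).add ((HasCoeffDerivAt.C_fun ((h.hasDerivAt_solitonU hp).const_mul 3)).mul
      (h.hasCoeffDerivAt_D_x h.contDiffOn_X hp))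
  exact h1.unique (h2.congr (I := (fun y => (y, t)) ⁻¹' Ω)
    (h.isOpen.preimage (Continuous.prodMk_left t)) hp fun y hy => h.solitonD_T hn hy)

/-- Every coefficient `q` of `P_x` evolves by `q_t = q_xxx + 3 (u q)_x`. -/
lemma deriv_coeff (h : IsSolitonRegion κ c θ (fun l => -8 * κ l ^ 3) (I ×ˢ J)) (hI : IsOpen I)
    (hn : 1 ≤ n) (hx : x ∈ I) (ht : t ∈ J) {u q : ℝ → ℝ → ℂ} (k : ℕ)
    (hJ : IsOpen J)
    (hu : ∀ x ∈ I, ∀ t ∈ J, u x t = solitonU κ c θ (fun l => -8 * κ l ^ 3) (x, t))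
    (hq : ∀ x ∈ I, ∀ t ∈ J,
      q x t = (solitonD κ c θ (fun l => -8 * κ l ^ 3) partialX (x, t)).coeff k) :
    deriv (fun s => q x s) t = iteratedDeriv 3 (fun y => q y t) x +
        3 * deriv (fun y => u y t * q y t) x := by
  have hp : ∀ {y}, y ∈ I → (y, t) ∈ I ×ˢ J := fun hy => ⟨hy, ht⟩
  have e1 := deriv_eq_of_eqOn hJ ht (h.hasCoeffDerivAt_D_t h.contDiffOn_X (hp hx) k)
    fun s hs => hq x hx s hs
  have e3 := iteratedDeriv_three_eq hI (h := fun y => q y t)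
    (e := fun y hy => hq y hy t ht)
    (d₁ := fun y hy => h.hasCoeffDerivAt_D_x h.contDiffOn_X (hp hy) k)
    (d₂ := fun y hy => h.hasCoeffDerivAt_D_x (D := fun G => partialX (partialX G))
      h.contDiffOn_XX (hp hy) k)
    (d₃ := fun y hy => h.hasCoeffDerivAt_D_x (D := fun G => partialX (partialX (partialX G)))
      h.contDiffOn_XXX (hp hy) k) hx
  have e2 := deriv_eq_of_eqOn hI (h := fun y => u y t * q y t) hx
    ((h.hasDerivAt_solitonU (hp hx)).fun_mul (h.hasCoeffDerivAt_D_x h.contDiffOn_X (hp hx) k))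
    fun y hy => by rw [hu y hy t ht, hq y hy t ht]
  rw [e1, e2, e3, h.solitonD_TX hn (hp hx)]
  simp only [coeff_add, coeff_C_mul]
  ring

end IsSolitonRegion

/-- A function given by the soliton formula is the potential built from Cramer's rule. -/
lemma IsSolitonFormula.eq_solitonU {I J : Set ℝ} {v : ℝ → ℂ} {t : ℝ} (hI : IsOpen I)
    (h : IsSolitonFormula κ c (fun l => θ l + η l * t) I v)
    (hR : IsSolitonRegion κ c θ η (I ×ˢ J)) (ht : t ∈ J) :
    ∀ x ∈ I, v x = solitonU κ c θ η (x, t) := by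
  obtain ⟨N, hN⟩ := h
  have e : ∀ y ∈ I, ∀ l, N l y = solitonN κ c θ η l (y, t) := fun y hy => by
    refine (eq_solitonN_iff (hR.det_ne_zero (y, t) ⟨hy, ht⟩) (fun l => N l y)).1 fun l => ?_
    have := (hN y hy).2.1 l
    rw [← add_assoc] at this
    exact this
  intro x hx
  rw [(hN x hx).2.2, solitonU]
  refine congrArg (2 * ·) (Finset.sum_congr rfl fun l _ => ?_)
  rw [deriv_eq_of_eqOn hI hx (hasDerivAt_partialX hR.isOpen (hR.contDiffOn l) ⟨hx, ht⟩)
    fun y hy => e y hy l]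

lemma isSolitonRegion_of_formula {I J : Set ℝ} {v : ℝ → ℝ → ℂ} (hκ : SolitonAdmissible κ c)
    (hI : IsOpen I) (hJ : IsOpen J)
    (h : ∀ t ∈ J, IsSolitonFormula κ c (fun l => θ l + η l * t) I (v t)) :
    IsSolitonRegion κ c θ η (I ×ˢ J) where
  admissible := hκ
  isOpen := hI.prod hJ
  det_ne_zero := by
    rintro ⟨x, t⟩ ⟨hx, ht⟩
    obtain ⟨N, hN⟩ := h t ht
    rw [← solitonMatrix_eq]
    exact (hN x hx).1

lemma IsSolitonProfile.exists_isLaxChain (hn : 1 ≤ n) {I : Set ℝ} {v : ℝ → ℂ} (hI : IsOpen I)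
    (h : IsSolitonProfile n I v) : ∃ f g : ℕ → ℝ → ℂ, IsLaxChain n I v f g := by
  obtain ⟨κ, c, θ, hκ, hf⟩ := h
  have hf' : ∀ t ∈ (Set.univ : Set ℝ),
      IsSolitonFormula κ c (fun l => θ l + (0 : Fin n → ℂ) l * t) I v := fun t _ => by
    simpa using hf
  have hR := isSolitonRegion_of_formula hκ hI isOpen_univ hf'
  exact ⟨_, _, hR.isLaxChain hn (Set.mem_univ 0)
    ((hf' 0 (Set.mem_univ 0)).eq_solitonU hI hR (Set.mem_univ 0))⟩

lemma IsSolitonSolution.solvesKdV_and_exists (hn : 1 ≤ n) {I J : Set ℝ} {u : ℝ → ℝ → ℂ}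
    (hI : IsOpen I) (hJ : IsOpen J) (h : IsSolitonSolution n I J u) :
    SolvesKdV I J u ∧
      ∃ f g : ℕ → ℝ → ℝ → ℂ, IsLaxChainXT n I J u f g ∧
        ∀ i ≤ n, ∀ x ∈ I, ∀ t ∈ J,
          deriv (fun s => f i x s) t = laxP (fun y => u y t) (fun y => f i y t) x := by
  obtain ⟨κ, c, θ, hκ, hf⟩ := h
  have hf' : ∀ t ∈ J, IsSolitonFormula κ c (fun l => θ l + -8 * κ l ^ 3 * t) I
      (fun x => u x t) := fun t ht => by
    have e : (fun l => θ l + -8 * κ l ^ 3 * t) = fun l => θ l - 8 * κ l ^ 3 * t := by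
      funext l; ring
    rw [e]
    exact hf t ht
  have hR := isSolitonRegion_of_formula (v := fun t x => u x t) (η := fun l => -8 * κ l ^ 3) hκ
    hI hJ hf'
  have hu : ∀ x ∈ I, ∀ t ∈ J, u x t = solitonU κ c θ (fun l => -8 * κ l ^ 3) (x, t) :=
    fun x hx t ht => IsSolitonFormula.eq_solitonU (η := fun l => -8 * κ l ^ 3) hI (hf' t ht) hR ht
      x hx
  have hu' : ∀ x ∈ I, ∀ t ∈ J,
      u x t = (solitonD κ c θ (fun l => -8 * κ l ^ 3) partialX (x, t)).coeff (n - 1) :=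
    fun x hx t ht => by rw [solitonD_partialX_coeff, hu x hx t ht]
  refine ⟨⟨?_, fun x hx t ht => ?_⟩, ?_⟩
  · refine hR.contDiffOn_solitonU.congr ?_
    rintro ⟨x, t⟩ ⟨hx, ht⟩
    exact hu x hx t ht
  · rw [hR.deriv_coeff hI hn hx ht (n - 1) hJ hu hu']
    have hd : HasDerivAt (fun y => u y t)
        (partialX (solitonU κ c θ fun l => -8 * κ l ^ 3) (x, t)) x := by
      refine (hR.hasDerivAt_solitonU ⟨hx, ht⟩).congr_of_eventuallyEq ?_
      filter_upwards [hI.mem_nhds hx] with y hy using hu y hy t ht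
    rw [(hd.fun_mul hd).deriv, hd.deriv]
    ring
  · refine ⟨fun i x t => solitonChainF κ c θ (fun l => -8 * κ l ^ 3) i (x, t),
      fun i x t => solitonChainG κ c θ (fun l => -8 * κ l ^ 3) i (x, t),
      ⟨fun t ht => hR.isLaxChain hn ht fun x hx => hu x hx t ht,
        fun i _ => hR.contDiffOn_solitonChainG i⟩, fun i hi x hx t ht => ?_⟩
    rw [laxP]
    exact hR.deriv_coeff hI hn hx ht (n - i) hJ hu fun x _ t _ => if_pos hi

end

/-! ### Constrained solutions of the KdV equation -/

/-- A smooth solution of the KdV equation on `I × J` subject to the constraint. -/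
structure IsKdVChain (n : ℕ) (I J : Set ℝ) (u : ℝ → ℝ → ℂ) (f g : ℕ → ℝ → ℝ → ℂ) : Prop where
  openI : IsOpen I
  openJ : IsOpen J
  kdv : SolvesKdV I J u
  lax : IsLaxChainXT n I J u f g

section Defs

variable (n : ℕ) (u : ℝ → ℝ → ℂ) (f g : ℕ → ℝ → ℝ → ℂ)

/-- The polynomial `P` of a chain depending on time. -/
def chainP (p : ℝ × ℝ) : ℂ[X] :=
  wavePoly (laxData n (fun i x => f i x p.2) (fun i x => g i x p.2) p.1)

/-- The polynomial `F = ∂ₓ P` of a chain depending on time. -/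
def chainF (p : ℝ × ℝ) : ℂ[X] :=
  waveDeriv (laxData n (fun i x => f i x p.2) (fun i x => g i x p.2) p.1)

/-- The image of `P` under a differential operator `D` annihilating the constants. -/
def chainD (D : (ℝ × ℝ → ℂ) → ℝ × ℝ → ℂ) (p : ℝ × ℝ) : ℂ[X] :=
  descPoly n (fun i => D (fun q => g (i + 1) q.1 q.2) p)

/-- The potential as a function on the plane. -/
def planeU (p : ℝ × ℝ) : ℂ := u p.1 p.2

/-- The failure of the evolution `P_t = (z² + 2 u) P_x - (z u + u_x) P`. -/
def defectP (p : ℝ × ℝ) : ℂ[X] :=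
  chainD n g partialT p - (X ^ 2 + C (2 * planeU u p)) * chainF n f g p +
    (X * C (planeU u p) + C (partialX (planeU u) p)) * chainP n f g p

/-- The `x`-derivative of `defectP`. -/
def defectF (p : ℝ × ℝ) : ℂ[X] :=
  chainD n g (fun G => partialT (partialX G)) p -
    (C (2 * partialX (planeU u) p) * chainF n f g p +
      (X ^ 2 + C (2 * planeU u p)) * (X * chainF n f g p - C (planeU u p) * chainP n f g p)) +
    ((X * C (partialX (planeU u) p) + C (partialX (partialX (planeU u)) p)) * chainP n f g p +
      (X * C (planeU u p) + C (partialX (planeU u) p)) * chainF n f g p)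

end Defs

lemma chainP_monic (n : ℕ) (f g : ℕ → ℝ → ℝ → ℂ) (p : ℝ × ℝ) : (chainP n f g p).Monic :=
  wavePoly_monic _

lemma chainP_natDegree (n : ℕ) (f g : ℕ → ℝ → ℝ → ℂ) (p : ℝ × ℝ) :
    (chainP n f g p).natDegree = n := wavePoly_natDegree _

lemma chainF_degree_lt (n : ℕ) (f g : ℕ → ℝ → ℝ → ℂ) (p : ℝ × ℝ) :
    (chainF n f g p).degree < n := waveDeriv_degree_lt _

lemma chainD_degree_lt (n : ℕ) (g : ℕ → ℝ → ℝ → ℂ) (D : (ℝ × ℝ → ℂ) → ℝ × ℝ → ℂ) (p : ℝ × ℝ) :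
    (chainD n g D p).degree < n := descPoly_degree_lt _ _

lemma natDegree_mul_defect_lt (n : ℕ) (u : ℝ → ℝ → ℂ) (f g : ℕ → ℝ → ℝ → ℂ) (p : ℝ × ℝ) :
    (chainP n f g p * defectF n u f g p - chainF n f g p * defectP n u f g p).natDegree <
      2 * n + 4 := by
  have hP : (chainP n f g p).natDegree ≤ n := (chainP_natDegree n f g p).le
  have hF : (chainF n f g p).natDegree ≤ n :=
    natDegree_le_of_degree_le (chainF_degree_lt n f g p).le
  have hD : ∀ D, (chainD n g D p).natDegree ≤ n := fun D =>
    natDegree_le_of_degree_le (chainD_degree_lt n g D p).le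
  have hC : ∀ a : ℂ, (C a : ℂ[X]).natDegree ≤ 0 := fun a => (natDegree_C a).le
  have hX : (X : ℂ[X]).natDegree ≤ 1 := natDegree_X_le
  have hX2 : (X ^ 2 : ℂ[X]).natDegree ≤ 2 := natDegree_X_pow_le 2
  have h1 : (defectP n u f g p).natDegree ≤ n + 3 := by
    refine (natDegree_add_le_of_le (natDegree_sub_le_of_le (hD _) (natDegree_mul_le_of_le
      (natDegree_add_le_of_le hX2 (hC _)) hF)) (natDegree_mul_le_of_le
      (natDegree_add_le_of_le (natDegree_mul_le_of_le hX (hC _)) (hC _)) hP)).trans ?_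
    simp; omega
  have h2 : (defectF n u f g p).natDegree ≤ n + 3 := by
    refine (natDegree_add_le_of_le (natDegree_sub_le_of_le (hD _) (natDegree_add_le_of_le
      (natDegree_mul_le_of_le (hC _) hF) (natDegree_mul_le_of_le
      (natDegree_add_le_of_le hX2 (hC _)) (natDegree_sub_le_of_le (natDegree_mul_le_of_le hX hF)
        (natDegree_mul_le_of_le (hC _) hP))))) (natDegree_add_le_of_le (natDegree_mul_le_of_le
      (natDegree_add_le_of_le (natDegree_mul_le_of_le hX (hC _)) (hC _)) hP)
      (natDegree_mul_le_of_le
      (natDegree_add_le_of_le (natDegree_mul_le_of_le hX (hC _)) (hC _)) hF))).trans ?_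
    simp; omega
  refine lt_of_le_of_lt (natDegree_sub_le_of_le (natDegree_mul_le_of_le hP h2)
    (natDegree_mul_le_of_le hF h1)) ?_
  simp; omega

namespace IsKdVChain

variable {n : ℕ} {I J : Set ℝ} {u : ℝ → ℝ → ℂ} {f g : ℕ → ℝ → ℝ → ℂ} {x t : ℝ}

lemma isOpen (h : IsKdVChain n I J u f g) : IsOpen (I ×ˢ J) := h.openI.prod h.openJ

lemma smoothG (h : IsKdVChain n I J u f g) {i : ℕ} (hi : i < n) :
    ContDiffOn ℝ ∞ (fun p : ℝ × ℝ => g (i + 1) p.1 p.2) (I ×ˢ J) := h.lax.smooth (i + 1) hi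

lemma smoothU (h : IsKdVChain n I J u f g) : ContDiffOn ℝ ∞ (planeU u) (I ×ˢ J) := h.kdv.1

lemma f_eq (h : IsKdVChain n I J u f g) {i : ℕ} (hi : i < n) {p : ℝ × ℝ} (hp : p ∈ I ×ˢ J) :
    f (i + 1) p.1 p.2 = partialX (fun q : ℝ × ℝ => g (i + 1) q.1 q.2) p :=
  ((h.lax.chain p.2 hp.2).primitive (i + 1) hi p.1 hp.1).unique
    (hasDerivAt_partialX h.isOpen (h.smoothG hi) hp)

lemma chainF_eq (h : IsKdVChain n I J u f g) {p : ℝ × ℝ} (hp : p ∈ I ×ˢ J) :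
    chainF n f g p = chainD n g partialX p := by
  rw [chainF, waveDeriv_laxData, chainD]
  exact descPoly_congr fun i hi => h.f_eq hi hp

lemma chainP_x (h : IsKdVChain n I J u f g) (hp : (x, t) ∈ I ×ˢ J) :
    HasCoeffDerivAt (fun y => chainP n f g (y, t)) (chainF n f g (x, t)) x :=
  (h.lax.chain t hp.2).hasCoeffDerivAt_wavePoly hp.1

lemma chainF_x (h : IsKdVChain n I J u f g) (hp : (x, t) ∈ I ×ˢ J) :
    HasCoeffDerivAt (fun y => chainF n f g (y, t))
      (X * chainF n f g (x, t) - C (planeU u (x, t)) * chainP n f g (x, t)) x :=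
  (h.lax.chain t hp.2).hasCoeffDerivAt_waveDeriv h.openI hp.1

lemma chainP_t (h : IsKdVChain n I J u f g) (hp : (x, t) ∈ I ×ˢ J) :
    HasCoeffDerivAt (fun s => chainP n f g (x, s)) (chainD n g partialT (x, t)) t := by
  simp only [chainP, wavePoly_laxData]
  have := (HasCoeffDerivAt.const (X ^ n) t).add (hasCoeffDerivAt_descPoly (n := n)
    fun i hi => hasDerivAt_partialT h.isOpen (h.smoothG hi) hp)
  rwa [zero_add] at this

lemma chainD_x (h : IsKdVChain n I J u f g) {D : (ℝ × ℝ → ℂ) → ℝ × ℝ → ℂ}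
    (hD : ∀ i < n, ContDiffOn ℝ ∞ (D fun p : ℝ × ℝ => g (i + 1) p.1 p.2) (I ×ˢ J))
    (hp : (x, t) ∈ I ×ˢ J) :
    HasCoeffDerivAt (fun y => chainD n g D (y, t)) (chainD n g (fun G => partialX (D G)) (x, t)) x :=
  hasCoeffDerivAt_descPoly (n := n) fun i hi => hasDerivAt_partialX h.isOpen (hD i hi) hp

lemma chainD_t (h : IsKdVChain n I J u f g) {D : (ℝ × ℝ → ℂ) → ℝ × ℝ → ℂ}
    (hD : ∀ i < n, ContDiffOn ℝ ∞ (D fun p : ℝ × ℝ => g (i + 1) p.1 p.2) (I ×ˢ J))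
    (hp : (x, t) ∈ I ×ˢ J) :
    HasCoeffDerivAt (fun s => chainD n g D (x, s)) (chainD n g (fun G => partialT (D G)) (x, t)) t :=
  hasCoeffDerivAt_descPoly (n := n) fun i hi => hasDerivAt_partialT h.isOpen (hD i hi) hp

lemma smoothX (h : IsKdVChain n I J u f g) : ∀ i < n,
    ContDiffOn ℝ ∞ (partialX fun p : ℝ × ℝ => g (i + 1) p.1 p.2) (I ×ˢ J) := fun _ hi =>
  contDiffOn_partialX h.isOpen (h.smoothG hi)

lemma smoothXX (h : IsKdVChain n I J u f g) : ∀ i < n,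
    ContDiffOn ℝ ∞ (partialX (partialX fun p : ℝ × ℝ => g (i + 1) p.1 p.2)) (I ×ˢ J) :=
  fun i hi => contDiffOn_partialX h.isOpen (h.smoothX i hi)

lemma slice_x (h : IsKdVChain n I J u f g) : IsOpen ((fun y => (y, t)) ⁻¹' (I ×ˢ J)) :=
  h.isOpen.preimage (Continuous.prodMk_left t)

lemma slice_t (h : IsKdVChain n I J u f g) : IsOpen ((fun s => (x, s)) ⁻¹' (I ×ˢ J)) :=
  h.isOpen.preimage (Continuous.prodMk_right x)

lemma chainF_t (h : IsKdVChain n I J u f g) (hp : (x, t) ∈ I ×ˢ J) :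
    HasCoeffDerivAt (fun s => chainF n f g (x, s))
      (chainD n g (fun G => partialT (partialX G)) (x, t)) t :=
  (h.chainD_t h.smoothX hp).congr h.slice_t hp fun _ hs => h.chainF_eq hs

lemma chainD_T_x (h : IsKdVChain n I J u f g) (hp : (x, t) ∈ I ×ˢ J) :
    HasCoeffDerivAt (fun y => chainD n g partialT (y, t))
      (chainD n g (fun G => partialT (partialX G)) (x, t)) x :=
  hasCoeffDerivAt_descPoly (n := n) fun _ hi => hasDerivAt_partialT_x h.isOpen (h.smoothG hi) hp

/-- The constraint `P_xx = X P_x - u P`. -/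
lemma chainD_XX (h : IsKdVChain n I J u f g) {p : ℝ × ℝ} (hp : p ∈ I ×ˢ J) :
    chainD n g (fun G => partialX (partialX G)) p =
      X * chainF n f g p - C (planeU u p) * chainP n f g p :=
  (h.chainD_x h.smoothX (x := p.1) (t := p.2) hp).unique
    ((h.chainF_x (x := p.1) (t := p.2) hp).congr h.slice_x hp
      fun _ hy => (h.chainF_eq hy).symm)

lemma planeU_x (h : IsKdVChain n I J u f g) (hp : (x, t) ∈ I ×ˢ J) :
    HasDerivAt (fun y => planeU u (y, t)) (partialX (planeU u) (x, t)) x :=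
  hasDerivAt_partialX h.isOpen h.smoothU hp

lemma planeU_xx (h : IsKdVChain n I J u f g) (hp : (x, t) ∈ I ×ˢ J) :
    HasDerivAt (fun y => partialX (planeU u) (y, t)) (partialX (partialX (planeU u)) (x, t)) x :=
  hasDerivAt_partialX h.isOpen (contDiffOn_partialX h.isOpen h.smoothU) hp

lemma planeU_xxx (h : IsKdVChain n I J u f g) (hp : (x, t) ∈ I ×ˢ J) :
    HasDerivAt (fun y => partialX (partialX (planeU u)) (y, t))
      (partialX (partialX (partialX (planeU u))) (x, t)) x :=
  hasDerivAt_partialX h.isOpen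
    (contDiffOn_partialX h.isOpen (contDiffOn_partialX h.isOpen h.smoothU)) hp

/-- The KdV equation in terms of partial derivatives. -/
lemma partialT_planeU (h : IsKdVChain n I J u f g) (hp : (x, t) ∈ I ×ˢ J) :
    partialT (planeU u) (x, t) = 6 * planeU u (x, t) * partialX (planeU u) (x, t) +
      partialX (partialX (partialX (planeU u))) (x, t) := by
  have e := h.kdv.2 x hp.1 t hp.2
  have e3 := iteratedDeriv_three_eq h.slice_x (h := fun y => u y t) (fun _ _ => rfl)
    (fun y hy => h.planeU_x hy) (fun y hy => h.planeU_xx hy) (fun y hy => h.planeU_xxx hy) hp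
  have e1 : deriv (fun y => u y t) x = partialX (planeU u) (x, t) := (h.planeU_x hp).deriv
  have e0 : deriv (fun s => u x s) t = partialT (planeU u) (x, t) :=
    (hasDerivAt_partialT h.isOpen h.smoothU hp).deriv
  rw [e0, e1, e3] at e
  exact e

/-- The equation `P_xx = X P_x - u P` differentiated in `t`. -/
lemma chainD_TX_x (h : IsKdVChain n I J u f g) (hp : (x, t) ∈ I ×ˢ J) :
    HasCoeffDerivAt (fun y => chainD n g (fun G => partialT (partialX G)) (y, t))
      (X * chainD n g (fun G => partialT (partialX G)) (x, t) -
        (C (partialT (planeU u) (x, t)) * chainP n f g (x, t) +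
          C (planeU u (x, t)) * chainD n g partialT (x, t))) x := by
  have h1 : HasCoeffDerivAt (fun y => chainD n g (fun G => partialT (partialX G)) (y, t))
      (chainD n g (fun G => partialT (partialX (partialX G))) (x, t)) x :=
    hasCoeffDerivAt_descPoly (n := n) fun i hi =>
      hasDerivAt_partialT_x h.isOpen (h.smoothX i hi) hp
  have h2 := h.chainD_t (D := fun G => partialX (partialX G)) h.smoothXX hp
  have h3 := ((h.chainF_t hp).const_mul X).sub ((HasCoeffDerivAt.C_fun
    (hasDerivAt_partialT h.isOpen h.smoothU hp)).mul (h.chainP_t hp))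
  rw [h2.unique (h3.congr h.slice_t hp fun _ hs => h.chainD_XX hs)] at h1
  exact h1

lemma defectP_x (h : IsKdVChain n I J u f g) (hp : (x, t) ∈ I ×ˢ J) :
    HasCoeffDerivAt (fun y => defectP n u f g (y, t)) (defectF n u f g (x, t)) x := by
  have h1 := ((h.chainD_T_x hp).sub (((HasCoeffDerivAt.const (X ^ 2) x).add
    (HasCoeffDerivAt.C_fun ((h.planeU_x hp).const_mul 2))).mul (h.chainF_x hp))).add
    ((((HasCoeffDerivAt.C_fun (h.planeU_x hp)).const_mul X).add
      (HasCoeffDerivAt.C_fun (h.planeU_xx hp))).mul (h.chainP_x hp))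
  refine (congrArg (HasCoeffDerivAt _ · x) ?_).mp h1
  rw [defectF]
  ring

/-- The defect solves `S_xx = X S_x - u S`; this is where the KdV equation enters. -/
lemma defectF_x (h : IsKdVChain n I J u f g) (hp : (x, t) ∈ I ×ˢ J) :
    HasCoeffDerivAt (fun y => defectF n u f g (y, t))
      (X * defectF n u f g (x, t) - C (planeU u (x, t)) * defectP n u f g (x, t)) x := by
  have h1 := ((h.chainD_TX_x hp).sub (((HasCoeffDerivAt.C_fun
    ((h.planeU_xx hp).const_mul 2)).mul (h.chainF_x hp)).add
      (((HasCoeffDerivAt.const (X ^ 2) x).add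
        (HasCoeffDerivAt.C_fun ((h.planeU_x hp).const_mul 2))).mul
          (((h.chainF_x hp).const_mul X).sub
            ((HasCoeffDerivAt.C_fun (h.planeU_x hp)).mul (h.chainP_x hp)))))).add
    (((((HasCoeffDerivAt.C_fun (h.planeU_xx hp)).const_mul X).add
      (HasCoeffDerivAt.C_fun (h.planeU_xxx hp))).mul (h.chainP_x hp)).add
     ((((HasCoeffDerivAt.C_fun (h.planeU_x hp)).const_mul X).add
      (HasCoeffDerivAt.C_fun (h.planeU_xx hp))).mul (h.chainF_x hp)))
  refine (congrArg (HasCoeffDerivAt _ · x) ?_).mp h1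
  rw [h.partialT_planeU hp, defectF, defectP]
  simp only [map_add, map_mul, map_ofNat]
  ring

/-- The defect `S` solves the same linear equation in `x` as `P`, so `T = P S_x - P_x S` satisfies
`T_x = X T`. A polynomial in `X` of bounded degree with this property is zero. -/
lemma mul_defect_eq (h : IsKdVChain n I J u f g) (hp : (x, t) ∈ I ×ˢ J) :
    chainP n f g (x, t) * defectF n u f g (x, t) =
      chainF n f g (x, t) * defectP n u f g (x, t) := by
  rw [← sub_eq_zero]
  refine eq_zero_of_hasCoeffDerivAt_X_mul (T := fun y => chainP n f g (y, t) *
    defectF n u f g (y, t) - chainF n f g (y, t) * defectP n u f g (y, t)) (h.slice_x (t := t))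
    (fun y _ => natDegree_mul_defect_lt n u f g (y, t)) (fun y hy => ?_) hp
  have h1 := ((h.chainP_x hy).mul (h.defectF_x hy)).sub ((h.chainF_x hy).mul (h.defectP_x hy))
  refine (congrArg (HasCoeffDerivAt _ · y) ?_).mp h1
  ring

/-- Because of the constraint the defect is also `P_t - P_xxx - 3 u P_x`, and `P` is monic. -/
lemma defectP_degree_lt (h : IsKdVChain n I J u f g) (hp : (x, t) ∈ I ×ˢ J) :
    (defectP n u f g (x, t)).degree < n := by
  have h1 := h.chainD_x (D := fun G => partialX (partialX G)) h.smoothXX hp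
  have h2 := ((h.chainF_x hp).const_mul X).sub ((HasCoeffDerivAt.C_fun
    (h.planeU_x hp)).mul (h.chainP_x hp))
  have e := h1.unique (h2.congr h.slice_x hp fun _ hy => h.chainD_XX hy)
  have e' : defectP n u f g (x, t) = chainD n g partialT (x, t) -
      chainD n g (fun G => partialX (partialX (partialX G))) (x, t) -
      C (3 * planeU u (x, t)) * chainF n f g (x, t) := by
    rw [e, defectP]
    simp only [map_mul, map_ofNat]
    ring
  rw [e', ← smul_eq_C_mul]
  exact (degree_sub_le _ _).trans_lt (max_lt ((degree_sub_le _ _).trans_lt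
    (max_lt (chainD_degree_lt _ _ _ _) (chainD_degree_lt _ _ _ _)))
    ((degree_smul_le _ _).trans_lt (chainF_degree_lt _ _ _ _)))

/-- Where `P` and `P_x` are coprime, they evolve in time by the linear system of the KdV equation. -/
lemma evolution (h : IsKdVChain n I J u f g) (hp : (x, t) ∈ I ×ˢ J)
    (hcop : IsCoprime (chainP n f g (x, t)) (chainF n f g (x, t))) :
    defectP n u f g (x, t) = 0 ∧ defectF n u f g (x, t) = 0 := by
  have hP0 := (chainP_monic n f g (x, t)).ne_zero
  have h1 := h.mul_defect_eq hp
  have h2 : chainP n f g (x, t) ∣ defectP n u f g (x, t) :=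
    hcop.dvd_of_dvd_mul_left ⟨_, h1.symm⟩
  have h3 : defectP n u f g (x, t) = 0 := by
    refine eq_zero_of_dvd_of_degree_lt h2 ((h.defectP_degree_lt hp).trans_le ?_)
    rw [degree_eq_natDegree hP0, chainP_natDegree]
  rw [h3, mul_zero, mul_eq_zero] at h1
  exact ⟨h3, h1.resolve_left hP0⟩

end IsKdVChain

namespace IsKdVChain

variable {n : ℕ} {I J : Set ℝ} {u : ℝ → ℝ → ℂ} {f g : ℕ → ℝ → ℝ → ℂ} {x t : ℝ}

/-- Where `P` and `P_x` are coprime, the spectrum does not move. -/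
lemma wronskian_t (h : IsKdVChain n I J u f g) (hp : (x, t) ∈ I ×ˢ J)
    (hcop : IsCoprime (chainP n f g (x, t)) (chainF n f g (x, t))) :
    HasCoeffDerivAt (fun s => wronskianPoly (chainP n f g (x, s)) (chainF n f g (x, s))) 0 t := by
  obtain ⟨e1, e2⟩ := h.evolution hp hcop
  have hP := h.chainP_t hp
  have hF := h.chainF_t hp
  have h1 := (((hP.const_mul X).mul hP.comp_neg).add (hP.mul hF.comp_neg)).sub (hP.comp_neg.mul hF)
  refine (congrArg (HasCoeffDerivAt _ · t) ?_).mp h1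
  have e1' := congrArg (fun Q : ℂ[X] => Q.comp (-X)) e1
  have e2' := congrArg (fun Q : ℂ[X] => Q.comp (-X)) e2
  simp only [defectP, defectF, sub_comp, add_comp, mul_comp, X_comp, C_comp, pow_comp,
    zero_comp, map_mul, map_ofNat, ofNat_comp] at e1 e2 e1' e2'
  linear_combination (X * (chainP n f g (x, t)).comp (-X) + (chainF n f g (x, t)).comp (-X)) * e1 +
    (X * chainP n f g (x, t) - chainF n f g (x, t)) * e1' +
    chainP n f g (x, t) * e2' - (chainP n f g (x, t)).comp (-X) * e2

/-- The gluing conditions are preserved in time, with factors varying as `exp (-8 (κ l)³ t)`, as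
long as `P` and `P_x` remain coprime. -/
lemma isGluedPair_of_isGluedPair (h : IsKdVChain n I J u f g) (hx : x ∈ I) {K : Set ℝ}
    (hK : K.OrdConnected) (hKJ : K ⊆ J)
    (hcop : ∀ t ∈ K, IsCoprime (chainP n f g (x, t)) (chainF n f g (x, t)))
    {κ β : Fin n → ℂ} {t₀ t₁ : ℝ} (ht₁ : t₁ ∈ K) (ht : t ∈ K)
    (h0 : IsGluedPair κ (fun l => β l * Complex.exp (-8 * κ l ^ 3 * (t₁ - t₀)))
      (chainP n f g (x, t₁)) (chainF n f g (x, t₁))) :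
    IsGluedPair κ (fun l => β l * Complex.exp (-8 * κ l ^ 3 * (t - t₀)))
      (chainP n f g (x, t)) (chainF n f g (x, t)) := by
  have hc : ∀ {G : ℝ × ℝ → ℂ}, ContDiffOn ℝ ∞ G (I ×ˢ J) → ContinuousOn (fun s => G (x, s)) K :=
    fun hG => hG.continuousOn.comp (Continuous.prodMk_right x).continuousOn
      fun s hs => ⟨hx, hKJ hs⟩
  have hu := hc h.smoothU
  have hux := hc (contDiffOn_partialX h.isOpen h.smoothU)
  have huxx := hc (contDiffOn_partialX h.isOpen (contDiffOn_partialX h.isOpen h.smoothU))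
  have key : ∀ l, _ := fun l => by
    have hE : ∀ s : ℝ, HasDerivAt (fun s : ℝ => β l * Complex.exp (-8 * κ l ^ 3 * (s - t₀)))
        (-8 * κ l ^ 3 * (β l * Complex.exp (-8 * κ l ^ 3 * (s - t₀)))) s := fun s => by
      have h1 : HasDerivAt (fun s : ℝ => -8 * κ l ^ 3 * ((s : ℂ) - t₀)) (-8 * κ l ^ 3) s := by
        exact (((Complex.ofRealCLM.hasDerivAt (x := s)).sub_const (t₀ : ℂ)).const_mul
          (-8 * κ l ^ 3)).congr_deriv (by simp)
      exact (h1.cexp.const_mul (β l)).congr_deriv (by ring)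
    have hdP : ∀ s, (chainP n f g (x, s)).natDegree < n + 1 := fun s => by
      rw [chainP_natDegree]; omega
    have hdF : ∀ s, (chainF n f g (x, s)).natDegree < n + 1 := fun s =>
      Nat.lt_succ_of_le (natDegree_le_of_degree_le (chainF_degree_lt _ _ _ _).le)
    have hP := fun (z : ℂ) (s : ℝ) (hs : s ∈ K) =>
      (h.chainP_t (x := x) (t := s) ⟨hx, hKJ hs⟩).eval hdP z
    have hF := fun (z : ℂ) (s : ℝ) (hs : s ∈ K) =>
      (h.chainF_t (x := x) (t := s) ⟨hx, hKJ hs⟩).eval hdF z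
    have ev := fun (z : ℂ) (s : ℝ) (hs : s ∈ K) =>
      h.evolution (x := x) (t := s) ⟨hx, hKJ hs⟩ (hcop s hs)
    have ev1 := fun (z : ℂ) (s : ℝ) (hs : s ∈ K) => congrArg (Polynomial.eval z) (ev z s hs).1
    have ev2 := fun (z : ℂ) (s : ℝ) (hs : s ∈ K) => congrArg (Polynomial.eval z) (ev z s hs).2
    simp only [defectP, defectF, eval_sub, eval_add, eval_mul, eval_X, eval_C, eval_pow,
      eval_zero] at ev1 ev2
    -- by `evolution` the defects of the two gluing conditions satisfy a linear system in `t`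
    exact linear_system_eq_zero hK
      (a := fun s => -(-(2 * κ l) * planeU u (x, s) + partialX (planeU u) (x, s)))
      (b := fun s => (2 * κ l) ^ 2 + 2 * planeU u (x, s))
      (c := fun s => -((2 * κ l) ^ 2 * planeU u (x, s) + 2 * planeU u (x, s) * planeU u (x, s) +
        -(2 * κ l) * partialX (planeU u) (x, s) + partialX (partialX (planeU u)) (x, s)))
      (d := fun s => -(2 * κ l) ^ 3 + -(2 * κ l) * planeU u (x, s) + partialX (planeU u) (x, s))
      (y₁ := fun s => (chainP n f g (x, s)).eval (-(2 * κ l)) -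
        β l * Complex.exp (-8 * κ l ^ 3 * (s - t₀)) * (chainP n f g (x, s)).eval (2 * κ l))
      (y₂ := fun s => (chainF n f g (x, s)).eval (-(2 * κ l)) -
        β l * Complex.exp (-8 * κ l ^ 3 * (s - t₀)) * ((chainF n f g (x, s)).eval (2 * κ l) -
          2 * κ l * (chainP n f g (x, s)).eval (2 * κ l)))
      (((continuousOn_const.mul hu).add hux).neg)
      (continuousOn_const.add (continuousOn_const.mul hu))
      ((((continuousOn_const.mul hu).add ((continuousOn_const.mul hu).mul hu)).add
        (continuousOn_const.mul hux)).add huxx).neg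
      ((continuousOn_const.add (continuousOn_const.mul hu)).add hux)
      (fun s hs => ((hP (-(2 * κ l)) s hs).fun_sub ((hE s).fun_mul (hP (2 * κ l) s hs))).congr_deriv
        (by
          linear_combination ev1 (-(2 * κ l)) s hs -
            β l * Complex.exp (-8 * κ l ^ 3 * (s - t₀)) * ev1 (2 * κ l) s hs))
      (fun s hs => ((hF (-(2 * κ l)) s hs).fun_sub ((hE s).fun_mul ((hF (2 * κ l) s hs).fun_sub
        ((hP (2 * κ l) s hs).const_mul (2 * κ l))))).congr_deriv (by
          linear_combination ev2 (-(2 * κ l)) s hs -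
            β l * Complex.exp (-8 * κ l ^ 3 * (s - t₀)) * (ev2 (2 * κ l) s hs -
              2 * κ l * ev1 (2 * κ l) s hs)))
      ht₁ (by simp [h0.1 l]) (by simp [h0.2 l]) ht
  exact ⟨fun l => sub_eq_zero.1 (key l).1, fun l => sub_eq_zero.1 (key l).2⟩

/-- Spectrum and gluing conditions at one time determine those at all times. The set of times at
which they are as predicted is closed by continuity. It is open, because at such a time `P` and `P_x`
are coprime, hence so they are at neighbouring times, where the evolution equations then hold. -/
lemma isGluedPair_time (h : IsKdVChain n I J u f g) (hx : x ∈ I) (hJ : J.OrdConnected)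
    {κ β : Fin n → ℂ} (hβ : ∀ l, β l ≠ 0) {t₀ : ℝ} (ht₀ : t₀ ∈ J)
    (hsep : (wronskianPoly (chainP n f g (x, t₀)) (chainF n f g (x, t₀))).Separable)
    (hroots : ∀ z, (wronskianPoly (chainP n f g (x, t₀)) (chainF n f g (x, t₀))).eval z = 0 →
      z = 0 ∨ ∃ j, z = 2 * κ j ∨ z = -(2 * κ j))
    (h0 : IsGluedPair κ β (chainP n f g (x, t₀)) (chainF n f g (x, t₀))) (ht : t ∈ J) :
    IsGluedPair κ (fun l => β l * Complex.exp (-8 * κ l ^ 3 * (t - t₀)))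
      (chainP n f g (x, t)) (chainF n f g (x, t)) := by
  set W : ℝ → ℂ[X] := fun s => wronskianPoly (chainP n f g (x, s)) (chainF n f g (x, s))
  -- the set of times at which spectrum and gluing conditions are as predicted
  set S : Set ℝ := {s | s ∈ J ∧ W s = W t₀ ∧
    IsGluedPair κ (fun l => β l * Complex.exp (-8 * κ l ^ 3 * (s - t₀)))
      (chainP n f g (x, s)) (chainF n f g (x, s))}
  have hcop : ∀ s ∈ S, IsCoprime (chainP n f g (x, s)) (chainF n f g (x, s)) := by
    rintro s ⟨_, hs1, hs2⟩
    have hs1' : wronskianPoly (chainP n f g (x, s)) (chainF n f g (x, s)) = W t₀ := hs1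
    refine hs2.isCoprime (fun l => mul_ne_zero (hβ l) (Complex.exp_ne_zero _)) ?_ ?_ <;>
    · rw [hs1']
      assumption
  have hopen : IsOpen S := by
    refine isOpen_iff_mem_nhds.2 fun t₁ ht₁ => ?_
    -- the resultant of `P` and `P_x` is continuous in time, so it does not vanish near `t₁`
    have hcont : ContinuousAt (fun s => MvPolynomial.eval
        (laxData n (fun i y => f i y s) (fun i y => g i y s) x) (resPoly n)) t₁ := by
      refine (MvPolynomial.continuous_eval (resPoly n)).continuousAt.comp
        (continuousAt_pi.2 ?_)
      have hp : (x, t₁) ∈ I ×ˢ J := ⟨hx, ht₁.1⟩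
      rintro (i | i)
      · exact (hasDerivAt_partialT h.isOpen (h.smoothG i.2) hp).continuousAt
      · refine (hasDerivAt_partialT h.isOpen (h.smoothX i i.2) hp).continuousAt.congr ?_
        filter_upwards [h.openJ.mem_nhds ht₁.1] with s hs
        exact (h.f_eq i.2 (p := (x, s)) ⟨hx, hs⟩).symm
    have hne := (eval_resPoly_ne_zero _).2 (hcop t₁ ht₁)
    obtain ⟨ε, hε, hball⟩ := Metric.mem_nhds_iff.1
      (Filter.inter_mem (h.openJ.mem_nhds ht₁.1) (hcont.eventually_ne hne))
    rw [Real.ball_eq_Ioo] at hball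
    have hcopK : ∀ s ∈ Set.Ioo (t₁ - ε) (t₁ + ε),
        IsCoprime (chainP n f g (x, s)) (chainF n f g (x, s)) := fun s hs =>
      (eval_resPoly_ne_zero _).1 (hball hs).2
    have hmem : t₁ ∈ Set.Ioo (t₁ - ε) (t₁ + ε) := ⟨by linarith, by linarith⟩
    refine Filter.mem_of_superset (isOpen_Ioo.mem_nhds hmem) fun s hs => ⟨(hball hs).1, ?_, ?_⟩
    · rw [← ht₁.2.1]
      exact eq_of_hasCoeffDerivAt_zero isOpen_Ioo Set.ordConnected_Ioo
        (fun r hr => h.wronskian_t ⟨hx, (hball hr).1⟩ (hcopK r hr)) hs hmem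
    · exact h.isGluedPair_of_isGluedPair hx Set.ordConnected_Ioo (fun r hr => (hball hr).1) hcopK
        hmem hs ht₁.2.2
  have hclosed : closure S ∩ J ⊆ S := by
    rintro s ⟨hs, hsJ⟩
    have hfreq := mem_closure_iff_frequently.1 hs
    -- equalities between continuous functions pass from `S` to its closure
    have hlim : ∀ {G H : ℝ → ℂ}, ContinuousAt G s → ContinuousAt H s →
        (∀ r ∈ S, G r = H r) → G s = H s := by
      intro G H hG hH e
      by_contra hne
      exact hfreq ((hG.sub hH).eventually_ne (sub_ne_zero.2 hne) |>.mono fun r hr hrS =>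
        hr (sub_eq_zero.2 (e r hrS)))
    have hp : (x, s) ∈ I ×ˢ J := ⟨hx, hsJ⟩
    have hP := h.chainP_t hp
    have hF := h.chainF_t hp
    have hdP : ∀ s, (chainP n f g (x, s)).natDegree < n + 1 := fun s => by
      rw [chainP_natDegree]; omega
    have hdF : ∀ s, (chainF n f g (x, s)).natDegree < n + 1 := fun s =>
      Nat.lt_succ_of_le (natDegree_le_of_degree_le (chainF_degree_lt _ _ _ _).le)
    have cP := fun z => (hP.eval hdP z).continuousAt
    have cF := fun z => (hF.eval hdF z).continuousAt
    have cE : ∀ l, ContinuousAt (fun r : ℝ => β l * Complex.exp (-8 * κ l ^ 3 * (r - t₀))) s :=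
      fun l => by fun_prop
    refine ⟨hsJ, ?_, fun l => ?_, fun l => ?_⟩
    · ext k
      exact hlim ((((hP.const_mul X).mul hP.comp_neg).add (hP.mul hF.comp_neg)).sub
        (hP.comp_neg.mul hF) k).continuousAt continuousAt_const
        fun r hr => congrArg (fun Q : ℂ[X] => Q.coeff k) hr.2.1
    · exact hlim (cP _) ((cE l).mul (cP _)) fun r hr => hr.2.2.1 l
    · exact hlim (cF _) ((cE l).mul ((cF _).sub (continuousAt_const.mul (cP _))))
        fun r hr => hr.2.2.2 l
  have ht₀S : t₀ ∈ S := ⟨ht₀, rfl, by simpa using h0⟩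
  exact (hJ.isPreconnected.subset_of_closure_inter_subset hopen ⟨t₀, ht₀, ht₀S⟩ hclosed ht).2.2

/-- A constrained KdV solution with a generic datum at one point is a soliton. -/
lemma isSolitonSolution (h : IsKdVChain n I J u f g) (hn : 1 ≤ n) (hI : I.OrdConnected)
    (hJ : J.OrdConnected) {x₀ t₀ : ℝ} (hx₀ : x₀ ∈ I) (ht₀ : t₀ ∈ J)
    (hD : MvPolynomial.eval (laxData n (fun i x => f i x t₀) (fun i x => g i x t₀) x₀)
      (discPoly n * resPoly n) ≠ 0) : IsSolitonSolution n I J u := by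
  rw [map_mul, mul_ne_zero_iff, eval_discPoly_ne_zero, eval_resPoly_ne_zero] at hD
  obtain ⟨κ, β, hκ, hβ, hg, hroots⟩ := exists_isGluedPair (wavePoly_monic _)
    (wavePoly_natDegree _) (waveDeriv_degree_lt _) hD.1 hD.2
  obtain ⟨θ, hθ⟩ := exists_phase hκ hβ x₀
  refine ⟨κ, fun _ => 1, fun l => θ l + 8 * κ l ^ 3 * t₀, hκ, fun t ht => ?_⟩
  refine (h.lax.chain t ht).isSolitonFormula h.openI hI hn hκ hx₀ ?_
  have e : (fun l => glueConst κ (fun _ => 1) l * Complex.exp (-2 * κ l * x₀ +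
      (θ l + 8 * κ l ^ 3 * t₀ - 8 * κ l ^ 3 * t))) =
      fun l => β l * Complex.exp (-8 * κ l ^ 3 * (t - t₀)) := by
    funext l
    rw [← hθ l, mul_assoc (glueConst _ _ _) (Complex.exp _), ← Complex.exp_add]
    ring_nf
  rw [e]
  exact h.isGluedPair_time hx₀ hJ hβ ht₀ hD.1 hroots hg ht

end IsKdVChain

end

theorem mainTheorem3 (n : ℕ) (hn : 1 ≤ n) :
    -- every soliton profile satisfies the constraint
    (∀ (I : Set ℝ) (v : ℝ → ℂ), IsOpen I → IsSolitonProfile n I v →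
      ∃ f g : ℕ → ℝ → ℂ, IsLaxChain n I v f g) ∧
    -- every soliton solves KdV and satisfies the constraint, whose functions evolve by `P`
    (∀ (I J : Set ℝ) (u : ℝ → ℝ → ℂ), IsOpen I → IsOpen J → IsSolitonSolution n I J u →
      SolvesKdV I J u ∧
      ∃ f g : ℕ → ℝ → ℝ → ℂ, IsLaxChainXT n I J u f g ∧
        ∀ i ≤ n, ∀ x ∈ I, ∀ t ∈ J,
          deriv (fun s => f i x s) t = laxP (fun y => u y t) (fun y => f i y t) x) ∧
    -- the general solution of the constraint is given by the solitons
    (∃ D : MvPolynomial (Fin n ⊕ Fin n) ℂ, D ≠ 0 ∧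
      -- solitons realise all initial data outside the hypersurface `D = 0`
      (∀ (p : Fin n ⊕ Fin n → ℂ) (x₀ : ℝ), MvPolynomial.eval p D ≠ 0 →
        ∃ ε > 0, ∃ (v : ℝ → ℂ) (f g : ℕ → ℝ → ℂ),
          IsLaxChain n (Set.Ioo (x₀ - ε) (x₀ + ε)) v f g ∧ laxData n f g x₀ = p ∧
          IsSolitonProfile n (Set.Ioo (x₀ - ε) (x₀ + ε)) v) ∧
      -- every solution with such data at one point is a soliton profile
      (∀ (I : Set ℝ) (x₀ : ℝ) (v : ℝ → ℂ) (f g : ℕ → ℝ → ℂ),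
        IsOpen I → I.OrdConnected → x₀ ∈ I → IsLaxChain n I v f g →
        MvPolynomial.eval (laxData n f g x₀) D ≠ 0 → IsSolitonProfile n I v) ∧
      -- every constrained KdV solution with such data at one point is a soliton
      (∀ (I J : Set ℝ) (x₀ t₀ : ℝ) (u : ℝ → ℝ → ℂ) (f g : ℕ → ℝ → ℝ → ℂ),
        IsOpen I → I.OrdConnected → x₀ ∈ I → IsOpen J → J.OrdConnected → t₀ ∈ J →
        SolvesKdV I J u → IsLaxChainXT n I J u f g →
        MvPolynomial.eval (laxData n (fun i x => f i x t₀) (fun i x => g i x t₀) x₀) D ≠ 0 →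
        IsSolitonSolution n I J u)) := by
  refine ⟨fun I v hI h => h.exists_isLaxChain hn hI,
    fun I J u hI hJ h => h.solvesKdV_and_exists hn hI hJ,
    discPoly n * resPoly n, mul_ne_zero (discPoly_ne_zero n) (resPoly_ne_zero hn), ?_, ?_, ?_⟩
  · intro p x₀ hD
    obtain ⟨ε, hε, v, f, g, h, hp⟩ := exists_isLaxChain p x₀
    exact ⟨ε, hε, v, f, g, h, hp, h.isSolitonProfile isOpen_Ioo Set.ordConnected_Ioo hn
      (x₀ := x₀) ⟨by linarith, by linarith⟩ (by rwa [hp])⟩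
  · intro I x₀ v f g hI hc hx₀ h hD
    exact h.isSolitonProfile hI hc hn hx₀ hD
  · intro I J x₀ t₀ u f g hI hIc hx₀ hJ hJc ht₀ hkdv hlax hD
    exact IsKdVChain.isSolitonSolution ⟨hI, hJ, hkdv, hlax⟩ hn hIc hJc hx₀ ht₀ hD
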